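/- Let $k$ be a field, $R=k[x,y]$ with the lexicographic term order $x>y$, and let $E\subset R$ be a monomial ideal with $\dim_k R/E<\infty$. Put $t=\min\{j: x^j\in E\}$, $m_i=\min\{j: x^{t-i}y^j\in E\}$ for $0\le i\le t$, $d_i=m_i-m_{i-1}$ for $1\le i\le t$, $u_{ij}=m_j-m_{i-1}+i-j$ for $1\le i\le t+1$, $1\le j\le t$, and $$\mathcal S(E)=\{(i,j): 1\le j<i\le t+1,\ 0\le u_{ij}<d_j\}.$$ Let $\mathbf A=\operatorname{Spec} k[p_{ij}:(i,j)\in\mathcal S(E)]$. For a point $p$ of $\mathbf A$ with values in an extension field $K$ of $k$, let $M(p)$ be the $(t+1)\times t$ matrix over $K[x,y]$ that is the sum of the matrix with diagonal entries $y^{d_j}$, entries $-x$ just below the diagonal and $0$ elsewhere, and of the matrix with entries $p_{ij}y^{u_{ij}}$ for $(i,j)\in\mathcal S(E)$ and $0$ elsewhere. Let $I_p\subset K[x,y]$ be the ideal of $t$-minors of $M(p)$. Recall that $V(E)$, the set of homogeneous ideals $I$ with leading term ideal $\operatorname{Lt}(I)=E$, is identified with the affine space $\mathbf A$ through $p\mapsto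 I_p$. For a homogeneous ideal $I$ let $\beta_{0,j}(I)$ be the number of minimal generators of $I$ of degree $j$. For $j\in\mathbf N$ and $u\in\mathbf Z$ let $V(E,j,\ge u)\subseteq\mathbf A$ be the set of the points $P$ such that the ideal $I_{p(P)}\subset\kappa(P)[x,y]$ attached to the coordinates $p(P)$ of $P$ in the residue field $\kappa(P)$ is homogeneous with leading term ideal $E\,\kappa(P)[x,y]$ and $\beta_{0,j}(I_{p(P)})\ge u$. For a sequence of integers $\beta=(\beta_j)_{j\ge 0}$ let $V(E,\ge\beta)\subseteq\mathbf A$ be the set of the points that satisfy these conditions with $u=\beta_j$ for every $j$. Put $a_i=t+1-i+m_{i-1}$ $(1\le i\le t+1)$, $b_i=a_{i+1}+1$ $(1\le i\le t)$, $w_j=\{i: a_i=j\}$, $v_j=\{i: b_i=j\}$, and let $M(p)_j$ be the submatrix of $M(p)$ modulo $(x,y)$ with rows $w_j$ and columns $v_j$. Then: 1. For every $j$, $V(E,j,\ge\beta_j)$ is closed in $\mathbf A$ and is the determinantal variety defined by $\operatorname{rank} M(p)_j\le \#w_j-\beta_j$. The entries of the matrices $M(p)_j$ are $0$, $1$ or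 variables $p_{i_1i_2}$, and for $i\ne j$ the sets of variables that occur in $M(p)_i$ and $M(p)_j$ are disjoint. 2. $V(E,\ge\beta)=\bigcap_j V(E,j,\ge\beta_j)$, and this intersection is transversal: at every point $P$ of it, the tangent spaces $T_P V(E,j,\ge\beta_j)$ (of the reduced structures) are in general position in $T_P\mathbf A$, that is, the map $T_P\mathbf A\to\prod_j T_P\mathbf A/T_PV(E,j,\ge\beta_j)$ is surjective. 3. $\operatorname{codim} V(E,\ge\beta)=\sum_j\operatorname{codim}V(E,j,\ge\beta_j)$, where the codimension in $\mathbf A$ of a closed set is the least codimension of its irreducible components, and $\infty$ for the empty set. 4. $V(E,\ge\beta)$ is irreducible if and only if $V(E,j,\ge\beta_j)$ is irreducible for every $j$ (irreducible sets being non-empty). -/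

import Mathlib

/-!
Throughout, `R = K[x, y]` is `MvPolynomial (Fin 2) K`, with `x = X 0` and `y = X 1`.
-/

namespace GroebnerCell

open MvPolynomial

universe u

noncomputable section

/-! ### Ideals of `K[x, y]`: leading term ideals, Groebner cells, Betti numbers, Betti strata -/

section Ideals

attribute [local instance] MvPolynomial.gradedAlgebra

variable {K : Type u} [Field K]

/-- `E` is generated by monomials. -/
def IsMonomialIdeal (E : Ideal (MvPolynomial (Fin 2) K)) : Prop :=
  ∃ s : Set (Fin 2 →₀ ℕ), E = Ideal.span ((fun e => monomial e (1 : K)) '' s)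

/-- The leading term ideal `Lt(I)` for the lexicographic term order with `x > y`. -/
def leadingTermIdeal (I : Ideal (MvPolynomial (Fin 2) K)) : Ideal (MvPolynomial (Fin 2) K) :=
  Ideal.span {g | ∃ f ∈ I, f ≠ 0 ∧ g = MonomialOrder.lex.leadingTerm f}

/-- `V(E)`: the homogeneous ideals `I` with `Lt(I) = E`. -/
def cell (E : Ideal (MvPolynomial (Fin 2) K)) : Set (Ideal (MvPolynomial (Fin 2) K)) :=
  {I | I.IsHomogeneous (homogeneousSubmodule (Fin 2) K) ∧ leadingTermIdeal I = E}

/-- The degree `j` component `I_j = I ∩ R_j`. -/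
def component (I : Ideal (MvPolynomial (Fin 2) K)) (j : ℕ) :
    Submodule K (MvPolynomial (Fin 2) K) :=
  I.restrictScalars K ⊓ homogeneousSubmodule (Fin 2) K j

/-- The Betti number `β_{0,j}(I) = dim_K (I / (x, y) I)_j = dim_K Tor_0(I, K)_j` of a homogeneous
ideal `I`, that is, the number of its minimal generators of degree `j`. -/
def betti (I : Ideal (MvPolynomial (Fin 2) K)) (j : ℕ) : ℕ :=
  Module.finrank K
    (component I j ⧸ (component (Ideal.span {X 0, X 1} * I) j).submoduleOf (component I j))

/-- `V(E, j, ≥ u)`, as a set of ideals. -/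
def stratumGE (E : Ideal (MvPolynomial (Fin 2) K)) (j : ℕ) (u : ℤ) :
    Set (Ideal (MvPolynomial (Fin 2) K)) :=
  {I | I ∈ cell E ∧ u ≤ (betti I j : ℤ)}

/-- `V(E, ≥ β) = ⋂ j, V(E, j, ≥ β j)`, as a set of ideals. -/
def multiStratumGE (E : Ideal (MvPolynomial (Fin 2) K)) (β : ℕ → ℤ) :
    Set (Ideal (MvPolynomial (Fin 2) K)) :=
  ⋂ j, stratumGE E j (β j)

end Ideals

/-! ### The numerical data of a monomial ideal `E` with `dim R / E` finite

The sequences `m_0, …, m_t` and `d_1, …, d_t`, the degrees `a_1, …, a_{t+1}` and `b_1, …, b_t`.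
Rows (`1, …, t + 1`) and columns (`1, …, t`) of matrices are indexed here by `Fin (t + 1)` and
`Fin t`, that is, they are numbered from `0`: row `r` is the row `i = r + 1` and column `c` is the
column `j = c + 1`. -/

section Data

variable {k : Type u} [Field k] (E : Ideal (MvPolynomial (Fin 2) k))

/-- `t = min {j : x ^ j ∈ E}`. -/
def tOf : ℕ := sInf {j | (X 0 : MvPolynomial (Fin 2) k) ^ j ∈ E}

/-- `m_i = min {j : x ^ (t - i) y ^ j ∈ E}`, for `0 ≤ i ≤ t`. -/
def mOf (i : ℕ) : ℕ :=
  sInf {j | (X 0 : MvPolynomial (Fin 2) k) ^ (tOf E - i) * X 1 ^ j ∈ E}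

/-- `d_j = m_j - m_{j-1}` for the column `j = c + 1`. -/
def dOf (c : Fin (tOf E)) : ℕ := mOf E (c + 1) - mOf E c

/-- `a_i = t + 1 - i + m_{i-1}` for the row `i = r + 1`. -/
def aOf (r : Fin (tOf E + 1)) : ℕ := tOf E - r + mOf E r

/-- `b_j = a_{j+1} + 1` for the column `j = c + 1`. -/
def bOf (c : Fin (tOf E)) : ℕ := aOf E c.succ + 1

/-- `u_{ij} = m_j - m_{i-1} + i - j` for the row `i = r + 1` and the column `j = c + 1`. -/
def uOf (r : Fin (tOf E + 1)) (c : Fin (tOf E)) : ℤ :=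
  (mOf E (c + 1) : ℤ) - mOf E r + r - c

/-- The index set `S(E) = {(i, j) : 1 ≤ j < i ≤ t + 1, 0 ≤ u_{ij} < d_j}` of the parameters. -/
def Param : Type :=
  {q : Fin (tOf E + 1) × Fin (tOf E) //
    (q.2 : ℕ) < q.1 ∧ 0 ≤ uOf E q.1 q.2 ∧ uOf E q.1 q.2 < dOf E q.2}

instance : Finite (Param E) := inferInstanceAs (Finite (Subtype _))

instance : Fintype (Param E) := Fintype.ofFinite _

/-- `w_j = {i : a_i = j}`. -/
abbrev Rows (j : ℕ) : Type := {r : Fin (tOf E + 1) // aOf E r = j}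

/-- `v_j = {i : b_i = j}`. -/
abbrev Cols (j : ℕ) : Type := {c : Fin (tOf E) // bOf E c = j}

/-! ### The Hilbert-Burch matrices `M(p) = M_0(E) + N` and the parametrization `p ↦ I_p` -/

section Matrices

variable {A : Type u} [CommRing A]

/-- `M_0(E)`: the diagonal entries are `y ^ d_j`, those just below the diagonal are `-x`. -/
def baseMatrix (A : Type u) [CommRing A] :
    Matrix (Fin (tOf E + 1)) (Fin (tOf E)) (MvPolynomial (Fin 2) A) :=
  fun r c => if (r : ℕ) = c then X 1 ^ dOf E c else if (r : ℕ) = c + 1 then - X 0 else 0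

open Classical in
/-- The matrix `N` with entries `p_{ij} y ^ u_{ij}` for `(i, j) ∈ S(E)`, and `0` elsewhere. -/
def paramMatrix (p : Param E → A) :
    Matrix (Fin (tOf E + 1)) (Fin (tOf E)) (MvPolynomial (Fin 2) A) :=
  fun r c =>
    if h : (c : ℕ) < r ∧ 0 ≤ uOf E r c ∧ uOf E r c < dOf E c then
      C (p ⟨(r, c), h⟩) * X 1 ^ (uOf E r c).toNat
    else 0

/-- `M(p) = M_0(E) + N`. -/
def hbMatrix (p : Param E → A) :
    Matrix (Fin (tOf E + 1)) (Fin (tOf E)) (MvPolynomial (Fin 2) A) :=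
  baseMatrix E A + paramMatrix E p

/-- The ideal `I_p` of the maximal minors of `M(p)`. -/
def hbIdeal (p : Param E → A) : Ideal (MvPolynomial (Fin 2) A) :=
  Ideal.span (Set.range fun r : Fin (tOf E + 1) => ((hbMatrix E p).submatrix r.succAbove id).det)

/-- `M(p)_j`: the submatrix of `M(p) ⊗ R / (x, y)` with rows `w_j` and columns `v_j`. -/
def degreeMatrix (p : Param E → A) (j : ℕ) : Matrix (Rows E j) (Cols E j) A :=
  fun r c => constantCoeff (hbMatrix E p r c)

end Matrices

/-! ### The strata as subsets of the affine space with coordinates `p_{ij}`, `(i, j) ∈ S(E)` -/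

/-- The coordinate ring `k[p_{ij} : (i, j) ∈ S(E)]`. -/
abbrev CoordRing : Type u := MvPolynomial (Param E) k

/-- `M(p)_j` for the generic point, whose coordinates are the variables `p_{ij}`. -/
def genericDegreeMatrix (j : ℕ) : Matrix (Rows E j) (Cols E j) (CoordRing E) :=
  degreeMatrix E (fun s => (X s : CoordRing E)) j

end Data

/-! ### Subsets of an affine space `𝔸 = Spec k[X_s : s ∈ σ]` -/

section Affine

variable {k : Type u} [Field k] {σ : Type} [Fintype σ]

/-- The coordinates, in the residue field `κ(P)`, of a point `P` of the affine space. -/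
def coords (P : PrimeSpectrum (MvPolynomial σ k)) (s : σ) : P.asIdeal.ResidueField :=
  algebraMap (MvPolynomial σ k) P.asIdeal.ResidueField (X s)

/-- The codimension of a closed subset of the affine space: the least codimension (height) of one
of its irreducible components, and `⊤` for the empty set. -/
def codim (Z : Set (PrimeSpectrum (MvPolynomial σ k))) : ℕ∞ :=
  (PrimeSpectrum.vanishingIdeal Z).height

/-- The Zariski tangent space at `P` of the closed subset `Z` with its reduced structure, as a
subspace of the tangent space `κ(P) ^ σ` of the affine space: the common zeros of the
differentials at `P` of the polynomials that vanish on `Z`. -/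
def tangentSpace (Z : Set (PrimeSpectrum (MvPolynomial σ k)))
    (P : PrimeSpectrum (MvPolynomial σ k)) : Submodule P.asIdeal.ResidueField
      (σ → P.asIdeal.ResidueField) where
  carrier := {v | ∀ f ∈ PrimeSpectrum.vanishingIdeal Z,
    ∑ s, algebraMap (MvPolynomial σ k) P.asIdeal.ResidueField (pderiv s f) * v s = 0}
  add_mem' := by
    intro v w hv hw f hf
    simp only [Pi.add_apply, mul_add, Finset.sum_add_distrib, hv f hf, hw f hf, add_zero]
  zero_mem' := by
    intro f _
    simp
  smul_mem' := by
    intro a v hv f hf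
    have := congrArg (a * ·) (hv f hf)
    simpa [Finset.mul_sum, mul_left_comm] using this

/-- The closed subsets `Z i` intersect transversally: at each common point `P`, their tangent
spaces are in general position in the tangent space `T` of the affine space, that is, the map
`T → ∏ i, T / T_P (Z i)` is surjective (for finitely many `Z i`: the codimension of the
intersection of the spaces `T_P (Z i)` is the sum of their codimensions). -/
def IntersectTransversally {ι : Type} (Z : ι → Set (PrimeSpectrum (MvPolynomial σ k))) : Prop :=
  ∀ P ∈ ⋂ i, Z i, ∀ w : ι → σ → P.asIdeal.ResidueField,
    ∃ v : σ → P.asIdeal.ResidueField, ∀ i, v - w i ∈ tangentSpace (Z i) P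

end Affine

section Loci

variable {k : Type u} [Field k] (E : Ideal (MvPolynomial (Fin 2) k))

/-- The ideal `E K[x, y]` for a field extension `K` of `k`. -/
def extend (K : Type u) [Field K] [Algebra k K] : Ideal (MvPolynomial (Fin 2) K) :=
  E.map (MvPolynomial.map (algebraMap k K))

/-- `V(E, j, ≥ u)` as a subset of the affine space `Spec k[p_{ij}]` that parametrizes `V(E)`: the
points `P` for which the ideal of `κ(P)[x, y]` with parameters `p(P)` lies in the stratum. -/
def stratumLocus (j : ℕ) (u : ℤ) : Set (PrimeSpectrum (CoordRing E)) :=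
  {P | hbIdeal E (coords P) ∈ stratumGE (extend E P.asIdeal.ResidueField) j u}

/-- `V(E, ≥ β)` as a subset of the affine space `Spec k[p_{ij}]` that parametrizes `V(E)`. -/
def multiStratumLocus (β : ℕ → ℤ) : Set (PrimeSpectrum (CoordRing E)) :=
  {P | hbIdeal E (coords P) ∈ multiStratumGE (extend E P.asIdeal.ResidueField) β}

/-- The subset of the affine space where `M(p)_j` has rank at most `#w_j - u`. -/
def determinantalLocus (j : ℕ) (u : ℤ) : Set (PrimeSpectrum (CoordRing E)) :=
  {P | ((degreeMatrix E (coords P) j).rank : ℤ) ≤ (Fintype.card (Rows E j) : ℤ) - u}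

/-- The variables that occur in the matrix `M(p)_j`. -/
def occurringVars (j : ℕ) : Set (Param E) :=
  {s | ∃ r c, s ∈ (genericDegreeMatrix E j r c).vars}

end Loci

end

end GroebnerCell

/-! The signed maximal minors `F_r` of `M(p)` satisfy one relation per column `c`: `y^d F_c = x
F_(c+1) +` a combination of terms `y^n F_r` with `r > c`. Descending induction gives `F_r` the
leading exponent of `x^(t-r) y^(m_r)`. Modulo the columns of `M(p)`, any coefficient vector can be
reduced to one whose entries have small `y`-degree, and the leading `y`-exponents of the terms of a
reduced combination are distinct, so nothing cancels. Hence `Lt(I_p) = E` and the columns generate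
the syzygies of the minors. Taking constant terms, the degree `j` part of `I_p / (x, y) I_p` is the
cokernel of `M(p)_j`, so `β_{0,j}(I_p) = #w_j - rank M(p)_j` (`betti_hbIdeal`).

In `M(p)_j` the columns with `d = 0` are unit vectors. Removing them and the rows of their entries
`1` leaves a staircase matrix of distinct variables (`rank_degreeMatrix`), and different `j` use
disjoint blocks of variables. Each stratum is therefore a cylinder over a rank locus in its own
block, and the rest concerns cylinders over disjoint blocks.

Transversality: derivatives in variables outside a block preserve the radical of an ideal coming
from the block, so the tangent space of the cylinder contains every direction that vanishes on the
block. Codimension: heights add for ideals in disjoint variables, by going down for flat maps and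
Krull's height theorem (`IsIndependentPair.height_sup`).

Irreducibility is the delicate point, because over a field that is not algebraically closed a
product of irreducible varieties may be reducible. The remedy is that a staircase matrix of rank at
most `n` is a sum of `n` rank one matrices supported in rectangles inside the staircase. The rank
locus is thus a finite union of closures of images of affine spaces. If it is irreducible, it is one
of them, and its coordinate ring embeds in a polynomial ring over `k`; such a ring stays a domain
after tensoring with any domain over `k`. -/

namespace GroebnerCell

/-! ### Heights and minimal primes for ideals extended from two independent rings -/

section IndependentPairs

theorem exists_minimalPrimes_height_eq {R : Type*} [CommRing R] [IsNoetherianRing R] {I : Ideal R}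
    (hI : I ≠ ⊤) : ∃ p ∈ I.minimalPrimes, p.height = I.height := by
  rw [Ideal.height_eq_inf_minimalPrimes]
  have hne : Nonempty I.minimalPrimes := Ideal.nonempty_minimalPrimes hI
  obtain ⟨⟨p, hp⟩, h⟩ := ciInf_mem (fun J : I.minimalPrimes => (J : Ideal R).height)
  exact ⟨p, hp, h.trans iInf_subtype⟩

/-- Flat maps satisfy going down, so the height of `P` is the height of its contraction plus the
height of `P` in the fibre ring. -/
theorem height_comap_le_of_flat {R S : Type*} [CommRing R] [CommRing S]
    [IsNoetherianRing R] [IsNoetherianRing S] {f : R →+* S} (hf : f.Flat) (P : Ideal S)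
    [P.IsPrime] : (P.comap f).height ≤ P.height := by
  algebraize [f]
  rw [Ideal.height_eq_height_add_of_liesOver_of_hasGoingDown (P.under R) P]
  exact le_self_add

theorem exists_le_comap_eq_of_flat {R S : Type*} [CommRing R] [CommRing S] {f : R →+* S}
    (hf : f.Flat) (P : Ideal S) [P.IsPrime] (p : Ideal R) [p.IsPrime] (h : p ≤ P.comap f) :
    ∃ Q ≤ P, Q.IsPrime ∧ Q.comap f = p := by
  algebraize [f]
  rcases h.eq_or_lt with h | h
  · exact ⟨P, le_rfl, inferInstance, h.symm⟩
  · obtain ⟨Q, hQ, hQ', hQ''⟩ := Ideal.exists_ideal_lt_liesOver_of_lt (q := P.under R) P h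
    exact ⟨Q, hQ.le, hQ', hQ''.over.symm⟩

/-- An ideal which is the kernel of a homomorphism into a polynomial ring. -/
def IsPolynomialKernel (k : Type*) {B : Type*} [Field k] [CommRing B] [Algebra k B]
    (q : Ideal B) : Prop :=
  ∃ (N : Type) (φ : B →ₐ[k] MvPolynomial N k), q = RingHom.ker φ

/-- The properties of the two homomorphisms from `A` and `B` to `R = A ⊗ B` that are needed here,
for algebras over the field `k`. -/
structure IsIndependentPair (k : Type*) {A B R : Type*} [Field k] [CommRing A] [CommRing B]
    [CommRing R] [Algebra k B] (i : A →+* R) (j : B →+* R) : Prop where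
  flat : i.Flat
  flat_left : ∀ J : Ideal B, ((Ideal.Quotient.mk (J.map j)).comp i).Flat
  flat_right : ∀ I : Ideal A, ((Ideal.Quotient.mk (I.map i)).comp j).Flat
  sup_ne_top : ∀ {I : Ideal A} {J : Ideal B}, I ≠ ⊤ → J ≠ ⊤ → I.map i ⊔ J.map j ≠ ⊤
  isPrime : ∀ {p : Ideal A} {q : Ideal B}, p.IsPrime → IsPolynomialKernel k q →
    (p.map i ⊔ q.map j).IsPrime

variable {k A B R : Type*} [Field k] [CommRing A] [CommRing B] [CommRing R] [Algebra k B]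
  {i : A →+* R} {j : B →+* R}

/-- Going down for `A → R` splits the height of `Q` into that of `Q ∩ A` and that of the image of
`Q` in `R / (Q ∩ A) R`. The latter ring is flat over `B`, and the image of `Q` contracts to `Q ∩ B`.
-/
theorem IsIndependentPair.height_comap_add_height_comap_le [IsNoetherianRing A]
    [IsNoetherianRing B] [IsNoetherianRing R] (h : IsIndependentPair k i j) (Q : Ideal R)
    [Q.IsPrime] : (Q.comap i).height + (Q.comap j).height ≤ Q.height := by
  have hf := h.flat
  have hfr := h.flat_right (Q.comap i)
  algebraize [i]
  have e2 : Q.height = (Q.comap i).height +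
      (Q.map (Ideal.Quotient.mk ((Q.comap i).map i))).height :=
    Ideal.height_eq_height_add_of_liesOver_of_hasGoingDown (Q.under A) Q
  rw [e2]
  refine add_le_add_right ?_ _
  have hle : (Q.comap i).map i ≤ Q := Ideal.map_comap_le
  have hprime : (Q.map (Ideal.Quotient.mk ((Q.comap i).map i))).IsPrime :=
    Ideal.isPrime_map_quotientMk_of_isPrime hle
  refine le_trans (le_of_eq ?_) (height_comap_le_of_flat hfr _)
  rw [← Ideal.comap_comap, Ideal.comap_map_of_surjective _ Ideal.Quotient.mk_surjective,
    ← RingHom.ker_eq_comap_bot, Ideal.mk_ker, sup_eq_left.mpr hle]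

/-- By going down for `A → R / J`, some prime of `R / J` below `P / J` lies over `p`. Its preimage
contains `p R + J`, so minimality makes it equal to `P`. -/
theorem comap_eq_of_mem_minimalPrimes_of_flat {p : Ideal A} [p.IsPrime] {J : Ideal R}
    (hf : ((Ideal.Quotient.mk J).comp i).Flat) {P : Ideal R}
    (hP : P ∈ (p.map i ⊔ J).minimalPrimes) : P.comap i = p := by
  have := hP.1.1
  have hJP : J ≤ P := le_sup_right.trans hP.1.2
  have hprime : (P.map (Ideal.Quotient.mk J)).IsPrime :=
    Ideal.isPrime_map_quotientMk_of_isPrime hJP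
  have hc : (P.map (Ideal.Quotient.mk J)).comap (Ideal.Quotient.mk J) = P := by
    rw [Ideal.comap_map_of_surjective _ Ideal.Quotient.mk_surjective,
      ← RingHom.ker_eq_comap_bot, Ideal.mk_ker, sup_eq_left.mpr hJP]
  obtain ⟨Q, hQP, hQ, hQp⟩ := exists_le_comap_eq_of_flat hf (P.map (Ideal.Quotient.mk J)) p (by
    rw [← Ideal.comap_comap, hc, ← Ideal.map_le_iff_le_comap]
    exact le_sup_left.trans hP.1.2)
  have hQ2 : Q.comap (Ideal.Quotient.mk J) ≤ P := hc ▸ Ideal.comap_mono hQP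
  have h2 := hP.2 (y := Q.comap (Ideal.Quotient.mk J)) ⟨inferInstance, sup_le ?_ ?_⟩ hQ2
  · rw [← hQp, ← Ideal.comap_comap, le_antisymm h2 hQ2]
  · rw [Ideal.map_le_iff_le_comap, Ideal.comap_comap, hQp]
  · intro x hx
    rw [Ideal.mem_comap, Ideal.Quotient.eq_zero_iff_mem.mpr hx]
    exact Q.zero_mem

/-- The upper bound is Krull's height theorem: primes `p` and `q` of least height over `I` and `J`
are minimal over ideals with as many generators as their heights, and a prime minimal over `p R + q
R` is minimal over all these generators together. The lower bound contracts a minimal prime of the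
sum to both rings. -/
theorem IsIndependentPair.height_sup [IsNoetherianRing A] [IsNoetherianRing B]
    [IsNoetherianRing R] (h : IsIndependentPair k i j) (I : Ideal A) (J : Ideal B) :
    (I.map i ⊔ J.map j).height = I.height + J.height := by
  apply le_antisymm
  · by_cases hI : I = ⊤
    · simp [hI]
    by_cases hJ : J = ⊤
    · simp [hJ]
    obtain ⟨p, hp, hpI⟩ := exists_minimalPrimes_height_eq hI
    obtain ⟨q, hq, hqJ⟩ := exists_minimalPrimes_height_eq hJ
    have := hp.1.1
    have := hq.1.1
    obtain ⟨P, hP⟩ := Ideal.nonempty_minimalPrimes (h.sup_ne_top hp.1.1.ne_top hq.1.1.ne_top)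
    have := hP.1.1
    obtain ⟨s, hs, hsc⟩ := p.exists_finset_card_eq_height_of_isNoetherianRing
    obtain ⟨s', hs', hsc'⟩ := q.exists_finset_card_eq_height_of_isNoetherianRing
    have hPl : P.comap i = p := comap_eq_of_mem_minimalPrimes_of_flat (h.flat_left q) hP
    have hPr : P.comap j = q :=
      comap_eq_of_mem_minimalPrimes_of_flat (h.flat_right p) (sup_comm (p.map i) _ ▸ hP)
    classical
    let T : Finset R := s.image i ∪ s'.image j
    have hT : Ideal.span (T : Set R) = (Ideal.span s).map i ⊔ (Ideal.span s').map j := by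
      simp [T, Ideal.map_span]
    -- A prime below `P` that contains `T` contracts into `p` and `q`. Minimality of these over
    -- their generators makes the contractions equal to `p` and `q`, so the prime contains `p R + q
    -- R`.
    have hmin : P ∈ (Ideal.span (T : Set R)).minimalPrimes := by
      rw [hT]
      refine ⟨⟨hP.1.1, ?_⟩, fun Q hQ hQP => ?_⟩
      · exact le_trans (sup_le_sup (Ideal.map_mono hs.1.2) (Ideal.map_mono hs'.1.2)) hP.1.2
      · have := hQ.1
        refine hP.2 ⟨hQ.1, sup_le ?_ ?_⟩ hQP
        · rw [Ideal.map_le_iff_le_comap]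
          refine hs.2 ⟨inferInstance, ?_⟩ (hPl ▸ Ideal.comap_mono hQP)
          rw [← Ideal.map_le_iff_le_comap]
          exact le_sup_left.trans hQ.2
        · rw [Ideal.map_le_iff_le_comap]
          refine hs'.2 ⟨inferInstance, ?_⟩ (hPr ▸ Ideal.comap_mono hQP)
          rw [← Ideal.map_le_iff_le_comap]
          exact le_sup_right.trans hQ.2
    calc _ ≤ P.height := Ideal.height_mono ((sup_le_sup (Ideal.map_mono hp.1.2)
            (Ideal.map_mono hq.1.2)).trans hP.1.2)
      _ ≤ T.card := Ideal.height_le_card_of_mem_minimalPrimes_span_finset hmin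
      _ ≤ (s.card + s'.card : ℕ) := by
        exact_mod_cast (Finset.card_union_le _ _).trans
          (add_le_add Finset.card_image_le Finset.card_image_le)
      _ = _ := by rw [Nat.cast_add, hsc, hsc', hpI, hqJ]
  · by_cases htop : I.map i ⊔ J.map j = ⊤
    · simp [htop]
    obtain ⟨Q, hQ, hQh⟩ := exists_minimalPrimes_height_eq htop
    rw [← hQh]
    have := hQ.1.1
    have h1 : I ≤ Q.comap i := Ideal.map_le_iff_le_comap.mp (le_sup_left.trans hQ.1.2)
    have h2 : J ≤ Q.comap j := Ideal.map_le_iff_le_comap.mp (le_sup_right.trans hQ.1.2)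
    exact (add_le_add (Ideal.height_mono h1) (Ideal.height_mono h2)).trans
      (h.height_comap_add_height_comap_le Q)

theorem IsIndependentPair.of_ringEquiv {R' : Type*} [CommRing R'] (h : IsIndependentPair k i j)
    (e : R ≃+* R') :
    IsIndependentPair k ((e : R →+* R').comp i) ((e : R →+* R').comp j) where
  flat := h.flat.comp (RingHom.Flat.of_bijective e.bijective)
  flat_left J := by
    have : (Ideal.Quotient.mk (J.map ((e : R →+* R').comp j))).comp ((e : R →+* R').comp i) =
        (Ideal.quotientEquiv (J.map j) (J.map ((e : R →+* R').comp j)) e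
          (Ideal.map_map _ _).symm : _ →+* _).comp ((Ideal.Quotient.mk (J.map j)).comp i) := by
      ext; rfl
    rw [this]
    exact (h.flat_left J).comp (RingHom.Flat.of_bijective (RingEquiv.bijective _))
  flat_right I := by
    have : (Ideal.Quotient.mk (I.map ((e : R →+* R').comp i))).comp ((e : R →+* R').comp j) =
        (Ideal.quotientEquiv (I.map i) (I.map ((e : R →+* R').comp i)) e
          (Ideal.map_map _ _).symm : _ →+* _).comp ((Ideal.Quotient.mk (I.map i)).comp j) := by
      ext; rfl
    rw [this]
    exact (h.flat_right I).comp (RingHom.Flat.of_bijective (RingEquiv.bijective _))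
  sup_ne_top {I J} hI hJ := by
    rw [← Ideal.map_map, ← Ideal.map_map, ← Ideal.map_sup]
    intro h'
    refine h.sup_ne_top hI hJ ?_
    rw [← Ideal.comap_map_of_bijective (e : R →+* R') e.bijective (I := I.map i ⊔ J.map j), h',
      Ideal.comap_top]
  isPrime {p q} hp hq := by
    rw [← Ideal.map_map, ← Ideal.map_map, ← Ideal.map_sup]
    have := h.isPrime hp hq
    exact Ideal.map_isPrime_of_equiv e

end IndependentPairs

/-! ### Tensor products of algebras over a field -/

section TensorProduct

open TensorProduct Algebra.TensorProduct

theorem flat_quotientMk_comp {A R S : Type*} [CommRing A] [CommRing R] [CommRing S]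
    {f : A →+* R} {ψ : R →+* S} (hψ : Function.Surjective ψ) (h : (ψ.comp f).Flat) {J : Ideal R}
    (hJ : RingHom.ker ψ = J) : ((Ideal.Quotient.mk J).comp f).Flat := by
  subst hJ
  let e := RingHom.quotientKerEquivOfSurjective hψ
  have : (Ideal.Quotient.mk (RingHom.ker ψ)).comp f = (e.symm : S →+* _).comp (ψ.comp f) := by
    ext x
    exact (e.symm_apply_apply (Ideal.Quotient.mk (RingHom.ker ψ) (f x))).symm
  rw [this]
  exact h.comp (RingHom.Flat.of_bijective e.symm.bijective)

variable (k A B : Type*) [Field k] [CommRing A] [CommRing B] [Algebra k A] [Algebra k B]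

variable {A} in
theorem ker_mkₐ (I : Ideal A) : RingHom.ker (Ideal.Quotient.mkₐ k I) = I :=
  Ideal.mk_ker

theorem flat_includeLeft : ((includeLeft : A →ₐ[k] A ⊗[k] B) : A →+* A ⊗[k] B).Flat := by
  change (algebraMap A (A ⊗[k] B)).Flat
  rw [RingHom.flat_algebraMap_iff]
  infer_instance

theorem flat_includeRight : ((includeRight : B →ₐ[k] A ⊗[k] B) : B →+* A ⊗[k] B).Flat := by
  have : ((includeRight : B →ₐ[k] A ⊗[k] B) : B →+* A ⊗[k] B) =
      ((Algebra.TensorProduct.comm k B A : B ⊗[k] A ≃ₐ[k] A ⊗[k] B) :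
        B ⊗[k] A →+* A ⊗[k] B).comp ((includeLeft : B →ₐ[k] B ⊗[k] A) : B →+* B ⊗[k] A) := by
    ext b
    simp
  rw [this]
  exact (flat_includeLeft k B A).comp (RingHom.Flat.of_bijective (AlgEquiv.bijective _))

/-- Quotients of `A ⊗ B` by extended ideals are again tensor products over the field `k`, hence flat
over either factor and nonzero if both factors are. For primality, `B / q` embeds in a polynomial
ring, so by flatness `(A / p) ⊗ (B / q)` embeds in a polynomial ring over the domain `A / p`. -/
theorem isIndependentPair_include : IsIndependentPair k
    ((includeLeft : A →ₐ[k] A ⊗[k] B) : A →+* A ⊗[k] B)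
    ((includeRight : B →ₐ[k] A ⊗[k] B) : B →+* A ⊗[k] B) where
  flat := flat_includeLeft k A B
  flat_left J := by
    refine flat_quotientMk_comp (ψ := (Algebra.TensorProduct.map (AlgHom.id k A)
      (Ideal.Quotient.mkₐ k J) : A ⊗[k] B →ₐ[k] A ⊗[k] (B ⧸ J)).toRingHom)
      (Algebra.TensorProduct.map_surjective _ _ Function.surjective_id
        (Ideal.Quotient.mkₐ_surjective k J)) ?_ ?_
    · convert flat_includeLeft k A (B ⧸ J) using 1
      ext a
      simp
    · have := Algebra.TensorProduct.lTensor_ker (A := A) (Ideal.Quotient.mkₐ k J)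
        (Ideal.Quotient.mkₐ_surjective k J)
      rw [ker_mkₐ] at this
      exact this
  flat_right I := by
    refine flat_quotientMk_comp (ψ := (Algebra.TensorProduct.map (Ideal.Quotient.mkₐ k I)
      (AlgHom.id k B) : A ⊗[k] B →ₐ[k] (A ⧸ I) ⊗[k] B).toRingHom)
      (Algebra.TensorProduct.map_surjective _ _
        (Ideal.Quotient.mkₐ_surjective k I) Function.surjective_id) ?_ ?_
    · convert flat_includeRight k (A ⧸ I) B using 1
      ext a
      simp
    · have := Algebra.TensorProduct.rTensor_ker (R := k) (S := k) (C := B) (Ideal.Quotient.mkₐ k I)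
        (Ideal.Quotient.mkₐ_surjective k I)
      rw [ker_mkₐ] at this
      exact this
  sup_ne_top {I J} hI hJ := by
    have h := Algebra.TensorProduct.map_ker (R := k) (S := k) (Ideal.Quotient.mkₐ k I)
      (Ideal.Quotient.mkₐ k J)
      (Ideal.Quotient.mkₐ_surjective k I) (Ideal.Quotient.mkₐ_surjective k J)
    rw [ker_mkₐ, ker_mkₐ] at h
    have := Ideal.Quotient.nontrivial_iff.mpr hI
    have := Ideal.Quotient.nontrivial_iff.mpr hJ
    have : Nontrivial ((A ⧸ I) ⊗[k] (B ⧸ J)) := inferInstance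
    exact fun h' => RingHom.ker_ne_top _ (h.trans h')
  isPrime {p q} hp hq := by
    obtain ⟨N, φ, rfl⟩ := hq
    have h := Algebra.TensorProduct.map_ker (R := k) (S := k) (Ideal.Quotient.mkₐ k p)
      φ.rangeRestrict
      (Ideal.Quotient.mkₐ_surjective k p) φ.rangeRestrict_surjective
    rw [ker_mkₐ, AlgHom.ker_rangeRestrict] at h
    have hinj : Function.Injective (Algebra.TensorProduct.map (AlgHom.id k (A ⧸ p))
        φ.range.val : (A ⧸ p) ⊗[k] φ.range →ₐ[k] _) :=
      Module.Flat.lTensor_preserves_injective_linearMap (M := A ⧸ p)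
        φ.range.val.toLinearMap Subtype.val_injective
    have hdom : IsDomain ((A ⧸ p) ⊗[k] MvPolynomial N k) :=
      (MvPolynomial.algebraTensorAlgEquiv k (A ⧸ p)).toMulEquiv.isDomain _
    have hdom' : IsDomain ((A ⧸ p) ⊗[k] φ.range) := hinj.isDomain
      (Algebra.TensorProduct.map (AlgHom.id k (A ⧸ p)) φ.range.val).toRingHom
    have hprime := RingHom.ker_isPrime
      (Algebra.TensorProduct.map (Ideal.Quotient.mkₐ k p) φ.rangeRestrict)
    rw [h] at hprime
    exact hprime

end TensorProduct

end GroebnerCell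

namespace GroebnerCell

/-! ### Minors and rank -/

section Minors

open Matrix

variable {K R S m n : Type*}

theorem exists_linearIndependent_col [Field K] [Fintype n] (M : Matrix m n K) [Finite m] {s : ℕ}
    (hs : s ≤ M.rank) : ∃ g : Fin s → n, LinearIndependent K fun i => M.col (g i) := by
  rw [rank_eq_finrank_span_cols] at hs
  obtain ⟨f, hf, -, hli⟩ := Submodule.exists_fun_fin_finrank_span_eq K (Set.range M.col)
  choose g hg using hf
  refine ⟨fun i => g (Fin.castLE hs i), ?_⟩
  simp only [hg]
  exact hli.comp _ (Fin.castLE_injective hs)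

theorem exists_det_submatrix_ne_zero [Field K] [Fintype m] [Fintype n] (M : Matrix m n K) {s : ℕ}
    (hs : s ≤ M.rank) :
    ∃ (f : Fin s → m) (g : Fin s → n), (M.submatrix f g).det ≠ 0 := by
  obtain ⟨g, hg⟩ := exists_linearIndependent_col M hs
  have h1 : ((M.submatrix id g)ᵀ).rank = s := by
    have h : LinearIndependent K ((M.submatrix id g)ᵀ).row := hg
    simpa using h.rank_matrix
  obtain ⟨f, hf⟩ := exists_linearIndependent_col _ h1.ge
  refine ⟨f, g, ?_⟩
  have h2 : LinearIndependent K (M.submatrix f g).row := hf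
  rw [linearIndependent_rows_iff_isUnit, isUnit_iff_isUnit_det] at h2
  exact h2.ne_zero

/-- The ideal generated by the minors of size `n + 1` of a matrix. -/
def minorIdeal [CommRing R] (M : Matrix m n R) (s : ℕ) : Ideal R :=
  Ideal.span {x | ∃ (f : Fin (s + 1) → m) (g : Fin (s + 1) → n), x = (M.submatrix f g).det}

theorem minorIdeal_map [CommRing R] [CommRing S] (φ : R →+* S) (M : Matrix m n R) (s : ℕ) :
    minorIdeal (M.map φ) s = (minorIdeal M s).map φ := by
  rw [minorIdeal, minorIdeal, Ideal.map_span]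
  congr 1
  ext x
  simp only [Set.mem_ofPred_eq, Set.mem_image]
  constructor
  · rintro ⟨f, g, rfl⟩
    refine ⟨_, ⟨f, g, rfl⟩, ?_⟩
    rw [RingHom.map_det]
    rfl
  · rintro ⟨_, ⟨f, g, rfl⟩, rfl⟩
    refine ⟨f, g, ?_⟩
    rw [RingHom.map_det]
    rfl

theorem minorIdeal_eq_bot_of_rank_le [CommRing R] [IsDomain R] [Fintype m] [Fintype n]
    {M : Matrix m n R} {s : ℕ} (h : M.rank ≤ s) : minorIdeal M s = ⊥ := by
  rw [minorIdeal, Ideal.span_eq_bot]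
  rintro x ⟨f, g, rfl⟩
  by_contra hd
  have h1 := rank_of_det_ne_zero hd
  have h2 := rank_submatrix_le M f g
  rw [h1, Fintype.card_fin] at h2
  omega

theorem minorIdeal_eq_bot_iff [Field K] [Fintype m] [Fintype n] {M : Matrix m n K} {s : ℕ} :
    minorIdeal M s = ⊥ ↔ M.rank ≤ s := by
  refine ⟨fun h => ?_, minorIdeal_eq_bot_of_rank_le⟩
  by_contra hr
  obtain ⟨f, g, hd⟩ := exists_det_submatrix_ne_zero M (s := s + 1) (by omega)
  rw [minorIdeal, Ideal.span_eq_bot] at h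
  exact hd (h _ ⟨f, g, rfl⟩)

/-- The minors in question have size `s + 1 ≥ 1`, so a matrix without rows has none. -/
theorem minorIdeal_of_isEmpty [CommRing R] [IsEmpty m] (M : Matrix m n R) (s : ℕ) :
    minorIdeal M s = ⊥ := by
  rw [minorIdeal, Ideal.span_eq_bot]
  rintro x ⟨f, g, rfl⟩
  exact isEmptyElim (f 0)

/-- Wedderburn's rank reduction: subtracting the product of the pivot column and the pivot row
lowers the rank. -/
theorem rank_sub_vecMulVec_lt [Field K] [Fintype m] [Fintype n] (M : Matrix m n K) (r : m) (c : n)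
    (h : M r c ≠ 0) :
    (M - vecMulVec (fun i => M i c / M r c) (M r)).rank < M.rank := by
  classical
  set M' := M - vecMulVec (fun i => M i c / M r c) (M r) with hM'
  -- The kernel of `M` is kept, and the unit vector at the pivot column is gained.
  have hker : LinearMap.ker M.mulVecLin < LinearMap.ker M'.mulVecLin := by
    refine lt_of_le_of_ne (fun v hv => ?_) fun heq => ?_
    · have hv' : M *ᵥ v = 0 := hv
      have h0 : M r ⬝ᵥ v = 0 := congrFun hv' r
      change M' *ᵥ v = 0
      rw [hM', sub_mulVec, hv', vecMulVec_mulVec, h0]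
      simp
    · have h1 : Pi.single c 1 ∈ LinearMap.ker M'.mulVecLin := by
        change M' *ᵥ Pi.single c 1 = 0
        ext i
        simp [hM', vecMulVec_apply, h]
      rw [← heq] at h1
      have h2 : M *ᵥ Pi.single c 1 = 0 := h1
      have h3 := congrFun h2 r
      simp at h3
      exact h h3
  have h1 := Submodule.finrank_lt_finrank_of_lt hker
  have h2 := M.mulVecLin.finrank_range_add_finrank_ker
  have h3 := M'.mulVecLin.finrank_range_add_finrank_ker
  rw [rank, rank]
  omega

end Minors

/-! ### Rank loci of generic staircase matrices -/

section Staircase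

open Matrix MvPolynomial

variable {ρ γ : Type} (a : ρ → ℕ) (b : γ → ℕ)

/-- The positions `(r, c)` of a staircase shape. -/
abbrev Stair : Type := {q : ρ × γ // b q.2 < a q.1}

/-- The matrix with given entries in the positions of a staircase shape, and `0` elsewhere. -/
def stairMatrix {R : Type*} [Zero R] (x : Stair a b → R) : Matrix ρ γ R :=
  fun r c => if h : b c < a r then x ⟨(r, c), h⟩ else 0

theorem stairMatrix_map {R S : Type*} [Zero R] [Zero S] (x : Stair a b → R) {φ : R → S}
    (h0 : φ 0 = 0) : (stairMatrix a b x).map φ = stairMatrix a b (fun q => φ (x q)) := by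
  ext r c
  simp only [Matrix.map_apply, stairMatrix]
  split_ifs <;> simp [h0]

variable {a b} in
/-- A staircase matrix of rank at most `n` over a field is a sum of `n` staircase matrices of rank
one which are supported in rectangles contained in the staircase. -/
theorem exists_stair_factorization {K : Type*} [Field K] [Fintype ρ] [Fintype γ] (n : ℕ)
    (M : Matrix ρ γ K) (hM : ∀ r c, M r c ≠ 0 → b c < a r) (hr : M.rank ≤ n) :
    ∃ (τ : Fin n → ℕ) (x : Matrix ρ (Fin n) K) (y : Matrix (Fin n) γ K), M = x * y ∧
      (∀ r l, x r l ≠ 0 → τ l ≤ a r) ∧ ∀ l c, y l c ≠ 0 → b c < τ l := by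
  induction n generalizing M with
  | zero =>
    refine ⟨0, 0, 0, ?_, by simp, by simp⟩
    ext r c
    by_contra h
    have := rank_sub_vecMulVec_lt M r c (by simpa using h)
    omega
  | succ n ih =>
    by_cases h0 : M = 0
    · exact ⟨0, 0, 0, by simp [h0], by simp, by simp⟩
    · have hne : ∃ r, ∃ c, M r c ≠ 0 := by
        by_contra! h
        exact h0 (by ext r c; exact h r c)
      -- With the pivot in a nonzero row of least `a`, the pivot column lives in rows with `a ≥ a r`
      -- and the pivot row in columns with `b < a r`. Their product is supported in a rectangle with
      -- threshold `a r` inside the staircase, so the difference is again a staircase matrix.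
      obtain ⟨r, ⟨c, hrc⟩, hmin⟩ := Set.exists_min_image {r | ∃ c, M r c ≠ 0} a
        (Set.toFinite _) hne
      have hlt := rank_sub_vecMulVec_lt M r c hrc
      obtain ⟨τ, x, y, hxy, hx, hy⟩ := ih
        (M - vecMulVec (fun i => M i c / M r c) (M r)) (fun r' c' h => by
          by_cases h1 : M r' c' = 0
          · rw [Matrix.sub_apply, h1, vecMulVec_apply, zero_sub, neg_ne_zero] at h
            have h2 : M r' c ≠ 0 := fun h3 => h (by simp [h3])
            exact (hM r c' (right_ne_zero_of_mul h)).trans_le (hmin r' ⟨c, h2⟩)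
          · exact hM _ _ h1) (by omega)
      let x' : Matrix ρ (Fin (n + 1)) K := .of fun i => Fin.cons (M i c / M r c) (x i)
      let y' : Matrix (Fin (n + 1)) γ K := .of fun l => Fin.cases (M r) y l
      refine ⟨Fin.cons (a r) τ, x', y', ?_, fun i l => ?_, fun l j => ?_⟩
      · ext i j
        have h1 := congrFun (congrFun hxy i) j
        rw [Matrix.sub_apply, vecMulVec_apply, sub_eq_iff_eq_add', Matrix.mul_apply] at h1
        rw [Matrix.mul_apply, Fin.sum_univ_succ, h1]
        rfl
      · refine Fin.cases (fun h => ?_) (fun l h => ?_) l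
        · exact hmin i ⟨c, fun h3 => h (by simp [x', h3])⟩
        · exact hx i l h
      · refine Fin.cases (fun h => ?_) (fun l h => ?_) l
        · exact hM r j h
        · exact hy l j h

variable (k : Type*) [Field k]

/-- The sum of `n` generic staircase matrices of rank one, supported in the rectangles with
thresholds `τ`. -/
noncomputable def rectHom {n : ℕ} (τ : Fin n → ℕ) :
    MvPolynomial (Stair a b) k →ₐ[k] MvPolynomial ((ρ × Fin n) ⊕ (Fin n × γ)) k :=
  aeval fun q => ∑ l, if τ l ≤ a q.1.1 ∧ b q.1.2 < τ l then
    X (Sum.inl (q.1.1, l)) * X (Sum.inr (l, q.1.2)) else 0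

/-- The staircase matrix whose entries are variables. -/
noncomputable def genericStair : Matrix ρ γ (MvPolynomial (Stair a b) k) := stairMatrix a b X

variable [Fintype ρ] [Fintype γ]

/-- `rectHom` sends the generic staircase matrix to a product of matrices over a domain whose inner
dimension is `n`. -/
theorem minorIdeal_genericStair_le_ker {n : ℕ} (τ : Fin n → ℕ) :
    minorIdeal (genericStair a b k) n ≤ RingHom.ker (rectHom a b k τ) := by
  let x : Matrix ρ (Fin n) (MvPolynomial ((ρ × Fin n) ⊕ (Fin n × γ)) k) :=
    fun r l => if τ l ≤ a r then X (Sum.inl (r, l)) else 0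
  let y : Matrix (Fin n) γ (MvPolynomial ((ρ × Fin n) ⊕ (Fin n × γ)) k) :=
    fun l c => if b c < τ l then X (Sum.inr (l, c)) else 0
  have h : (genericStair a b k).map (rectHom a b k τ).toRingHom = x * y := by
    rw [genericStair, stairMatrix_map _ _ _ (map_zero _)]
    ext1 r c
    rw [Matrix.mul_apply, stairMatrix]
    split_ifs with hrc
    · rw [AlgHom.toRingHom_eq_coe, RingHom.coe_coe, rectHom, aeval_X]
      refine Finset.sum_congr rfl fun l _ => ?_
      by_cases h1 : τ l ≤ a r <;> by_cases h2 : b c < τ l <;> simp [x, y, h1, h2]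
    · refine (Finset.sum_eq_zero fun l _ => ?_).symm
      by_cases h1 : τ l ≤ a r <;> by_cases h2 : b c < τ l <;> simp [x, y, h1, h2]
      omega
  have h2 : minorIdeal ((genericStair a b k).map (rectHom a b k τ).toRingHom) n = ⊥ := by
    rw [h]
    refine minorIdeal_eq_bot_of_rank_le ((Matrix.rank_mul_le_left _ _).trans ?_)
    simpa using x.rank_le_card_width
  rw [minorIdeal_map, Ideal.map_eq_bot_iff_le_ker] at h2
  exact h2

/-- Over the residue field of `Q` the generic matrix has rank at most `n`. A factorization along
thresholds `τ` supplies values for the variables of the target of `rectHom`, through which the map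
to the residue field then factors. So the images of the `rectHom` parametrizations cover the rank
locus. -/
theorem exists_ker_rectHom_le {n : ℕ} {Q : Ideal (MvPolynomial (Stair a b) k)} [Q.IsPrime]
    (hQ : minorIdeal (genericStair a b k) n ≤ Q) :
    ∃ τ : Fin n → ℕ, RingHom.ker (rectHom a b k τ) ≤ Q := by
  set φ := algebraMap (MvPolynomial (Stair a b) k) Q.ResidueField with hφ
  have h1 : minorIdeal ((genericStair a b k).map φ) n = ⊥ := by
    rw [minorIdeal_map, Ideal.map_eq_bot_iff_le_ker, hφ, Ideal.ker_algebraMap_residueField]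
    exact hQ
  rw [minorIdeal_eq_bot_iff, genericStair, stairMatrix_map _ _ _ (map_zero _)] at h1
  obtain ⟨τ, x, y, hxy, hx, hy⟩ := exists_stair_factorization (a := a) (b := b) n _
    (fun r c h => by
      by_contra h'
      exact h (by simp [stairMatrix, h'])) h1
  refine ⟨τ, fun f hf => ?_⟩
  have hcomp : IsScalarTower.toAlgHom k (MvPolynomial (Stair a b) k) Q.ResidueField =
      (aeval (Sum.elim (fun q => x q.1 q.2) (fun q => y q.1 q.2))).comp (rectHom a b k τ) := by
    ext q
    obtain ⟨⟨r, c⟩, h⟩ := q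
    have h2 := congrFun (congrFun hxy r) c
    rw [stairMatrix, dif_pos h, Matrix.mul_apply] at h2
    simp only [IsScalarTower.coe_toAlgHom', AlgHom.comp_apply, rectHom, aeval_X, map_sum]
    rw [← hφ, h2]
    refine Finset.sum_congr rfl fun l _ => ?_
    split_ifs with h3
    · simp
    · rw [map_zero]
      by_contra h4
      exact h3 ⟨hx r l (left_ne_zero_of_mul h4), hy l c (right_ne_zero_of_mul h4)⟩
  rw [← Ideal.algebraMap_residueField_eq_zero]
  have := DFunLike.congr_fun hcomp f
  rw [AlgHom.comp_apply, (RingHom.mem_ker).mp hf, map_zero] at this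
  exact this

/-- When the rank locus is irreducible, its generic point already lies in the closure of the image
for a single `τ`. -/
theorem isPolynomialKernel_radical_minorIdeal {n : ℕ}
    (h : IsIrreducible (PrimeSpectrum.zeroLocus (minorIdeal (genericStair a b k) n :
      Set (MvPolynomial (Stair a b) k)))) :
    IsPolynomialKernel k (minorIdeal (genericStair a b k) n).radical := by
  have hprime := (PrimeSpectrum.isIrreducible_zeroLocus_iff _).mp h
  obtain ⟨τ, hτ⟩ := exists_ker_rectHom_le a b k
    (Ideal.le_radical (I := minorIdeal (genericStair a b k) n))
  refine ⟨_, rectHom a b k τ, le_antisymm ?_ hτ⟩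
  rw [Ideal.IsRadical.radical_le_iff (Ideal.IsPrime.isRadical (RingHom.ker_isPrime _))]
  exact minorIdeal_genericStair_le_ker a b k τ

end Staircase

end GroebnerCell

namespace GroebnerCell

/-! ### Ideals in disjoint sets of variables -/

section PolynomialPairs

open MvPolynomial

variable {k : Type*} [Field k] {σ : Type}

theorem isIndependentPair_rename {T₁ T₂ : Type} {ι₁ : T₁ → σ} {ι₂ : T₂ → σ}
    (h : Function.Bijective (Sum.elim ι₁ ι₂)) :
    IsIndependentPair k (rename ι₁ : MvPolynomial T₁ k →ₐ[k] MvPolynomial σ k).toRingHom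
      (rename ι₂ : MvPolynomial T₂ k →ₐ[k] MvPolynomial σ k).toRingHom := by
  let e := (tensorEquivSum k T₁ T₂ k).trans (renameEquiv k (Equiv.ofBijective _ h))
  have := (isIndependentPair_include k (MvPolynomial T₁ k) (MvPolynomial T₂ k)).of_ringEquiv
    e.toRingEquiv
  convert this using 1
  · apply MvPolynomial.ringHom_ext
    · intro r
      simp [e]
    · intro s
      simp [e]
  · apply MvPolynomial.ringHom_ext
    · intro r
      simp [e]
    · intro s
      simp [e]

theorem bijective_elim_compl_range {T : Type} {ι : T → σ} (h : Function.Injective ι) :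
    Function.Bijective (Sum.elim (Subtype.val : ↥(Set.range ι)ᶜ → σ) ι) := by
  constructor
  · exact Subtype.val_injective.sumElim h fun a b hab => a.2 ⟨b, hab.symm⟩
  · intro s
    by_cases hs : s ∈ Set.range ι
    · obtain ⟨t, rfl⟩ := hs
      exact ⟨Sum.inr t, rfl⟩
    · exact ⟨Sum.inl ⟨s, hs⟩, rfl⟩

/-- The ideal of `k[σ]` generated by an ideal of polynomials in the variables `ι t`. -/
noncomputable abbrev extendVars {T : Type} (ι : T → σ) (J : Ideal (MvPolynomial T k)) :
    Ideal (MvPolynomial σ k) :=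
  J.map (rename ι : MvPolynomial T k →ₐ[k] MvPolynomial σ k).toRingHom

theorem extendVars_comp {T T' : Type} (ι : T → T') (ι' : T' → σ) (J : Ideal (MvPolynomial T k)) :
    extendVars ι' (extendVars ι J) = extendVars (ι' ∘ ι) J := by
  rw [extendVars, extendVars, Ideal.map_map]
  congr 1
  ext x
  · simp
  · simp

/-- The ideal `I` is generated by polynomials in the variables from `S`. -/
def IsExtendedFrom (S : Set σ) (I : Ideal (MvPolynomial σ k)) : Prop :=
  ∃ J : Ideal (MvPolynomial S k), I = extendVars Subtype.val J

theorem IsExtendedFrom.of_range_subset {T : Type} {ι : T → σ} {S : Set σ} (h : Set.range ι ⊆ S)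
    (J : Ideal (MvPolynomial T k)) : IsExtendedFrom S (extendVars ι J) :=
  ⟨extendVars (fun t => (⟨ι t, h ⟨t, rfl⟩⟩ : S)) J, by rw [extendVars_comp]; rfl⟩

theorem IsExtendedFrom.bot (S : Set σ) : IsExtendedFrom S (⊥ : Ideal (MvPolynomial σ k)) :=
  ⟨⊥, by simp⟩

theorem IsExtendedFrom.sup {S : Set σ} {I I' : Ideal (MvPolynomial σ k)}
    (h : IsExtendedFrom S I) (h' : IsExtendedFrom S I') : IsExtendedFrom S (I ⊔ I') := by
  obtain ⟨J, rfl⟩ := h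
  obtain ⟨J', rfl⟩ := h'
  exact ⟨J ⊔ J', by rw [extendVars, extendVars, extendVars, Ideal.map_sup]⟩

theorem IsExtendedFrom.finset_sup {α : Type*} {S : Set σ} (F : Finset α)
    {I : α → Ideal (MvPolynomial σ k)} (h : ∀ j ∈ F, IsExtendedFrom S (I j)) :
    IsExtendedFrom S (F.sup I) :=
  Finset.sup_induction (IsExtendedFrom.bot S) (fun _ h _ h' => h.sup h') h

theorem comap_extendVars {T : Type} {ι : T → σ} (h : Function.Injective ι)
    (J : Ideal (MvPolynomial T k)) :
    (extendVars ι J).comap (rename ι : MvPolynomial T k →ₐ[k] MvPolynomial σ k).toRingHom = J := by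
  refine le_antisymm (fun f hf => ?_) Ideal.le_comap_map
  -- Setting the other variables to `0` is a retraction of `rename ι`.
  have h1 : (killCompl h).toRingHom.comp
      (rename ι : MvPolynomial T k →ₐ[k] MvPolynomial σ k).toRingHom = RingHom.id _ := by
    apply MvPolynomial.ringHom_ext
    · intro r
      simp
    · intro x
      simpa using DFunLike.congr_fun (killCompl_comp_rename (R := k) h) (X x)
  have h2 := Ideal.mem_map_of_mem (killCompl h).toRingHom (Ideal.mem_comap.mp hf)
  rw [extendVars, Ideal.map_map, h1, Ideal.map_id] at h2
  rwa [← RingHom.comp_apply, h1] at h2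

theorem isPolynomialKernel_bot {T : Type} :
    IsPolynomialKernel k (⊥ : Ideal (MvPolynomial T k)) :=
  ⟨T, AlgHom.id k _, by
    ext f
    simp [RingHom.mem_ker]⟩

theorem isPrime_extendVars {T : Type} {ι : T → σ} (h : Function.Injective ι)
    {p : Ideal (MvPolynomial T k)} (hp : p.IsPrime) : (extendVars ι p).IsPrime := by
  have hb : Function.Bijective (Sum.elim ι (Subtype.val : ↥(Set.range ι)ᶜ → σ)) := by
    have := (bijective_elim_compl_range h).comp (Equiv.sumComm T ↥(Set.range ι)ᶜ).bijective
    convert this using 1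
    ext x
    cases x <;> rfl
  have := (isIndependentPair_rename (k := k) hb).isPrime hp isPolynomialKernel_bot
  rwa [Ideal.map_bot, sup_bot_eq] at this

theorem radical_extendVars_isPrime_iff {T : Type} {ι : T → σ} (h : Function.Injective ι)
    (J : Ideal (MvPolynomial T k)) : (extendVars ι J).radical.IsPrime ↔ J.radical.IsPrime := by
  constructor
  · intro hp
    rw [← comap_extendVars h J, ← Ideal.comap_radical]
    infer_instance
  · intro hp
    have h1 : (extendVars ι J).radical = extendVars ι J.radical := by
      apply le_antisymm
      · rw [(isPrime_extendVars h hp).isRadical.radical_le_iff]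
        exact Ideal.map_mono Ideal.le_radical
      · exact Ideal.map_radical_le _
    rw [h1]
    exact isPrime_extendVars h hp

section Pair

variable {T₁ T₂ : Type} {ι₁ : T₁ → σ} {ι₂ : T₂ → σ}

theorem height_extendVars_sup [Finite σ] (h : Function.Bijective (Sum.elim ι₁ ι₂))
    (I : Ideal (MvPolynomial T₁ k)) (J : Ideal (MvPolynomial T₂ k)) :
    (extendVars ι₁ I ⊔ extendVars ι₂ J).height =
      (extendVars ι₁ I).height + (extendVars ι₂ J).height := by
  have : Finite (T₁ ⊕ T₂) := Finite.of_injective _ h.1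
  have : Finite T₁ := Finite.of_injective (Sum.inl : T₁ → T₁ ⊕ T₂) Sum.inl_injective
  have : Finite T₂ := Finite.of_injective (Sum.inr : T₂ → T₁ ⊕ T₂) Sum.inr_injective
  have hp := isIndependentPair_rename (k := k) h
  have h1 := hp.height_sup I J
  have h2 := hp.height_sup I ⊥
  have h3 := hp.height_sup ⊥ J
  rw [Ideal.map_bot, sup_bot_eq, Ideal.height_bot, add_zero] at h2
  rw [Ideal.map_bot, bot_sup_eq, Ideal.height_bot, zero_add] at h3
  rw [h1, h2, h3]

/-- The sum of the extended radicals is prime, hence radical, so it is the radical of the sum. -/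
theorem radical_extendVars_sup_isPrime (h : Function.Bijective (Sum.elim ι₁ ι₂))
    (I : Ideal (MvPolynomial T₁ k)) (J : Ideal (MvPolynomial T₂ k))
    (hI : (extendVars ι₁ I).radical.IsPrime)
    (hJ : IsPolynomialKernel k J.radical) :
    (extendVars ι₁ I ⊔ extendVars ι₂ J).radical.IsPrime := by
  have hinj : Function.Injective ι₁ := h.1.comp Sum.inl_injective
  rw [radical_extendVars_isPrime_iff hinj] at hI
  have hP := (isIndependentPair_rename (k := k) h).isPrime hI hJ
  have h1 : (extendVars ι₁ I ⊔ extendVars ι₂ J).radical =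
      extendVars ι₁ I.radical ⊔ extendVars ι₂ J.radical := by
    apply le_antisymm
    · rw [hP.isRadical.radical_le_iff]
      exact sup_le_sup (Ideal.map_mono Ideal.le_radical) (Ideal.map_mono Ideal.le_radical)
    · refine sup_le ?_ ?_
      · exact (Ideal.map_radical_le _).trans (Ideal.radical_mono le_sup_left)
      · exact (Ideal.map_radical_le _).trans (Ideal.radical_mono le_sup_right)
  rw [h1]
  exact hP

/-- The projection of a product to its second factor is surjective when the first factor is
non-empty: each prime `q` over `J` is the contraction of a minimal prime of `I + q`. So `J.radical`
is the contraction of the radical of the sum. -/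
theorem radical_extendVars_isPrime_of_sup (h : Function.Bijective (Sum.elim ι₁ ι₂))
    (I : Ideal (MvPolynomial T₁ k)) (J : Ideal (MvPolynomial T₂ k))
    (hP : (extendVars ι₁ I ⊔ extendVars ι₂ J).radical.IsPrime) :
    (extendVars ι₂ J).radical.IsPrime := by
  have hinj : Function.Injective ι₂ := h.1.comp Sum.inr_injective
  rw [radical_extendVars_isPrime_iff hinj]
  have hp := isIndependentPair_rename (k := k) h
  have hI : I ≠ ⊤ := by
    rintro rfl
    refine hP.ne_top ?_
    rw [Ideal.radical_eq_top, extendVars, Ideal.map_top, top_sup_eq]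
  have h1 : J.radical = (extendVars ι₁ I ⊔ extendVars ι₂ J).radical.comap
      (rename ι₂ : MvPolynomial T₂ k →ₐ[k] MvPolynomial σ k).toRingHom := by
    apply le_antisymm
    · rw [Ideal.comap_radical]
      exact Ideal.radical_mono (Ideal.map_le_iff_le_comap.mp le_sup_right)
    · rw [Ideal.radical_eq_sInf J]
      refine le_sInf fun q hq => ?_
      have := hq.2
      obtain ⟨P, hP'⟩ := Ideal.nonempty_minimalPrimes (hp.sup_ne_top hI this.ne_top)
      have := hP'.1.1
      have h2 := comap_eq_of_mem_minimalPrimes_of_flat (hp.flat_right I) (p := q) (P := P)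
        (sup_comm (extendVars ι₁ I) _ ▸ hP')
      rw [← h2]
      refine Ideal.comap_mono ?_
      rw [this.isRadical.radical_le_iff]
      exact (sup_le_sup le_rfl (Ideal.map_mono hq.1)).trans hP'.1.2
  rw [h1]
  infer_instance

end Pair

section Family

variable {α : Type*} {T : α → Type} {ι : ∀ j, T j → σ}

theorem isExtendedFrom_compl_range
    (hd : ∀ i j, i ≠ j → Disjoint (Set.range (ι i)) (Set.range (ι j)))
    (J : ∀ j, Ideal (MvPolynomial (T j) k)) {j : α} {F : Finset α} (hj : j ∉ F) :
    IsExtendedFrom (Set.range (ι j))ᶜ (F.sup fun i => extendVars (ι i) (J i)) := by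
  refine IsExtendedFrom.finset_sup F fun i hi => IsExtendedFrom.of_range_subset ?_ _
  rw [Set.subset_compl_iff_disjoint_right]
  exact hd i j (fun h => hj (h ▸ hi))

/-- At each step of the induction the block of `j` is paired with all the remaining variables, which
include those of the other blocks. -/
theorem height_finset_sup_extendVars [Finite σ] (hι : ∀ j, Function.Injective (ι j))
    (hd : ∀ i j, i ≠ j → Disjoint (Set.range (ι i)) (Set.range (ι j)))
    (J : ∀ j, Ideal (MvPolynomial (T j) k)) (F : Finset α) :
    (F.sup fun i => extendVars (ι i) (J i)).height = ∑ i ∈ F, (extendVars (ι i) (J i)).height := by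
  classical
  induction F using Finset.induction_on with
  | empty => simp
  | insert j F hj ih =>
    obtain ⟨I, hI⟩ := isExtendedFrom_compl_range hd J hj
    rw [Finset.sup_insert, Finset.sum_insert hj, ← ih, hI, sup_comm,
      height_extendVars_sup (bijective_elim_compl_range (hι j)), add_comm]

theorem radical_finset_sup_isPrime (hι : ∀ j, Function.Injective (ι j))
    (hd : ∀ i j, i ≠ j → Disjoint (Set.range (ι i)) (Set.range (ι j)))
    (J : ∀ j, Ideal (MvPolynomial (T j) k))
    (hJ : ∀ j, (J j).radical.IsPrime → IsPolynomialKernel k (J j).radical) (F : Finset α)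
    (hF : ∀ j ∈ F, (extendVars (ι j) (J j)).radical.IsPrime) :
    (F.sup fun i => extendVars (ι i) (J i)).radical.IsPrime := by
  classical
  induction F using Finset.induction_on with
  | empty =>
    rw [Finset.sup_empty, Ideal.IsRadical.radical]
    · exact Ideal.isPrime_bot
    · exact Ideal.isPrime_bot.isRadical
  | insert j F hj ih =>
    obtain ⟨I, hI⟩ := isExtendedFrom_compl_range hd J hj
    have h1 := ih fun i hi => hF i (Finset.mem_insert_of_mem hi)
    rw [Finset.sup_insert, sup_comm]
    rw [hI] at h1 ⊢
    refine radical_extendVars_sup_isPrime (bijective_elim_compl_range (hι j)) _ _ h1 (hJ j ?_)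
    rw [← radical_extendVars_isPrime_iff (hι j)]
    exact hF j (Finset.mem_insert_self j F)

theorem radical_isPrime_of_finset_sup (hι : ∀ j, Function.Injective (ι j))
    (hd : ∀ i j, i ≠ j → Disjoint (Set.range (ι i)) (Set.range (ι j)))
    (J : ∀ j, Ideal (MvPolynomial (T j) k))
    {F : Finset α}
    (hF : (F.sup fun i => extendVars (ι i) (J i)).radical.IsPrime) {j : α} (hj : j ∈ F) :
    (extendVars (ι j) (J j)).radical.IsPrime := by
  classical
  rw [← Finset.insert_erase hj, Finset.sup_insert, sup_comm] at hF
  obtain ⟨I, hI⟩ := isExtendedFrom_compl_range hd J (Finset.notMem_erase j F)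
  rw [hI] at hF
  exact radical_extendVars_isPrime_of_sup (bijective_elim_compl_range (hι j)) _ _ hF

end Family

end PolynomialPairs

end GroebnerCell

namespace GroebnerCell

/-! ### Codimension and tangent spaces of cylinders -/

section Transversality

open MvPolynomial

variable {k : Type*} [Field k] {σ : Type}

/-- Taylor expansion to first order in the variable `s`. It expresses the derivative through a ring
homomorphism, which behaves well with powers. -/
theorem coeff_one_shift [DecidableEq σ] (s : σ) (f : MvPolynomial σ k) :
    (aeval (fun x => Polynomial.C (X x) + if x = s then Polynomial.X else 0 :
        σ → Polynomial (MvPolynomial σ k)) f).coeff 0 = f ∧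
    (aeval (fun x => Polynomial.C (X x) + if x = s then Polynomial.X else 0 :
        σ → Polynomial (MvPolynomial σ k)) f).coeff 1 = pderiv s f := by
  induction f using MvPolynomial.induction_on with
  | C a =>
    rw [algHom_C, Polynomial.algebraMap_apply, Polynomial.coeff_C_zero,
      Polynomial.coeff_C_of_ne_zero one_ne_zero]
    simp [algebraMap_eq]
  | add p q hp hq => simp [hp, hq]
  | mul_X p x hp =>
    rw [map_mul, aeval_X]
    split_ifs with h
    · subst h
      rw [mul_add, Polynomial.coeff_add, Polynomial.coeff_add, Polynomial.coeff_mul_C,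
        Polynomial.coeff_mul_C, Polynomial.coeff_mul_X, Polynomial.coeff_mul_X_zero, hp.1, hp.2]
      simp [mul_comm, add_comm]
    · simp [hp, Derivation.leibniz, pderiv_X_of_ne h, mul_comm]

/-- The partial derivatives with respect to the other variables preserve the radical of an ideal
that is generated by polynomials in the variables `ι t`. -/
theorem pderiv_mem_radical_extendVars {T : Type} (ι : T → σ) (J : Ideal (MvPolynomial T k))
    {s : σ} (hs : s ∉ Set.range ι) {f : MvPolynomial σ k} (hf : f ∈ (extendVars ι J).radical) :
    pderiv s f ∈ (extendVars ι J).radical := by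
  classical
  let φ : MvPolynomial σ k →ₐ[k] Polynomial (MvPolynomial σ k) :=
    aeval (fun x => Polynomial.C (X x) + if x = s then Polynomial.X else 0)
  set I := extendVars ι J with hI
  -- The shift in `s` fixes the generators of `I`, since they do not involve `s`.
  have hφ : I.map φ.toRingHom ≤ I.map Polynomial.C := by
    have : φ.toRingHom.comp (rename ι : MvPolynomial T k →ₐ[k] MvPolynomial σ k).toRingHom =
        Polynomial.C.comp (rename ι : MvPolynomial T k →ₐ[k] MvPolynomial σ k).toRingHom := by
      apply MvPolynomial.ringHom_ext
      · intro r
        simp [φ, Polynomial.algebraMap_apply, algebraMap_eq]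
      · intro t
        have : ι t ≠ s := fun h => hs ⟨t, h⟩
        simp [φ, this]
    rw [hI, extendVars, Ideal.map_map, Ideal.map_map, this]
  obtain ⟨n, hn⟩ := hf
  have h1 : φ f ^ n ∈ I.map Polynomial.C := by
    rw [← map_pow]
    exact hφ (Ideal.mem_map_of_mem φ.toRingHom hn)
  -- A nilpotent polynomial over `R / I` has nilpotent coefficients, and the linear one is the class
  -- of `pderiv s f`. No assumption on the characteristic enters.
  have h2 : IsNilpotent ((φ f).map (Ideal.Quotient.mk I)) := by
    refine ⟨n, ?_⟩
    rw [← Polynomial.map_pow]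
    rw [Ideal.mem_map_C_iff] at h1
    ext m
    rw [Polynomial.coeff_map, Polynomial.coeff_zero, Ideal.Quotient.eq_zero_iff_mem]
    exact h1 m
  rw [Polynomial.isNilpotent_iff] at h2
  obtain ⟨m, hm⟩ := h2 1
  rw [Polynomial.coeff_map, (coeff_one_shift s f).2, ← map_pow, Ideal.Quotient.eq_zero_iff_mem]
    at hm
  exact ⟨m, hm⟩

theorem codim_zeroLocus (I : Ideal (MvPolynomial σ k)) :
    codim (PrimeSpectrum.zeroLocus (I : Set (MvPolynomial σ k))) = I.height := by
  rw [codim, PrimeSpectrum.vanishingIdeal_zeroLocus_eq_radical]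
  rw [Ideal.height_eq_inf_minimalPrimes, Ideal.height_eq_inf_minimalPrimes,
    Ideal.radical_minimalPrimes]

variable [Fintype σ]

/-- In the differential of `f` at `P`, the block variables contribute nothing because `v` vanishes
there; the other derivatives lie in the radical, hence in `P`. -/
theorem mem_tangentSpace_of_vanishing {T : Type} (ι : T → σ) (J : Ideal (MvPolynomial T k))
    {P : PrimeSpectrum (MvPolynomial σ k)}
    (hP : P ∈ PrimeSpectrum.zeroLocus (extendVars ι J : Set (MvPolynomial σ k)))
    {v : σ → P.asIdeal.ResidueField} (hv : ∀ t, v (ι t) = 0) :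
    v ∈ tangentSpace (PrimeSpectrum.zeroLocus (extendVars ι J : Set (MvPolynomial σ k))) P := by
  intro f hf
  rw [PrimeSpectrum.vanishingIdeal_zeroLocus_eq_radical] at hf
  refine Finset.sum_eq_zero fun s _ => ?_
  by_cases hs : s ∈ Set.range ι
  · obtain ⟨t, rfl⟩ := hs
    rw [hv, mul_zero]
  · have h1 := pderiv_mem_radical_extendVars ι J hs hf
    have h2 : (extendVars ι J).radical ≤ P.asIdeal := P.isPrime.isRadical.radical_le_iff.mpr hP
    rw [Ideal.algebraMap_residueField_eq_zero.mpr (h2 h1), zero_mul]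

end Transversality

/-! ### Intersections of cylinders over disjoint blocks -/

section Family

theorem tsum_eq_top_of_eq_top {α : Type*} (f : α → ℕ∞) {j : α} (h : f j = ⊤) : ∑' i, f i = ⊤ := by
  refine HasSum.tsum_eq (tendsto_const_nhds.congr' ?_)
  filter_upwards [Filter.eventually_ge_atTop {j}] with s hs
  rw [eq_comm, ← top_le_iff, ← h]
  exact Finset.single_le_sum_of_canonicallyOrdered (hs (Finset.mem_singleton_self j))

open MvPolynomial

variable {k : Type*} [Field k] {σ : Type} {T : ℕ → Type} {ι : ∀ j, T j → σ}
  {Z : ℕ → Set (PrimeSpectrum (MvPolynomial σ k))}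

theorem intersectTransversally_of_disjoint [Fintype σ]
    (hd : ∀ i j, i ≠ j → Disjoint (Set.range (ι i)) (Set.range (ι j)))
    (J : ∀ j, Ideal (MvPolynomial (T j) k))
    (hZ : ∀ j, Z j = PrimeSpectrum.zeroLocus (extendVars (ι j) (J j) : Set (MvPolynomial σ k))) :
    IntersectTransversally Z := by
  classical
  intro P hP w
  rw [Set.mem_iInter] at hP
  -- The vector `v` copies `w j` on the block of `j`. The blocks are disjoint, so these
  -- prescriptions do not conflict.
  refine ⟨fun s => if h : ∃ j, s ∈ Set.range (ι j) then w h.choose s else 0, fun j => ?_⟩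
  have hPj := hP j
  rw [hZ] at hPj ⊢
  refine mem_tangentSpace_of_vanishing _ _ hPj fun t => ?_
  have h : ∃ i, ι j t ∈ Set.range (ι i) := ⟨j, t, rfl⟩
  have h1 : h.choose = j := by
    by_contra hne
    exact Set.disjoint_left.mp (hd _ _ hne) h.choose_spec ⟨t, rfl⟩
  rw [Pi.sub_apply, dif_pos h, h1, sub_self]

theorem iInter_zeroLocus_eq_finset_sup {I : ℕ → Ideal (MvPolynomial σ k)} {F : Finset ℕ}
    (hF : ∀ j ∉ F, I j = ⊥) :
    ⋂ j, PrimeSpectrum.zeroLocus (I j : Set (MvPolynomial σ k)) =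
      PrimeSpectrum.zeroLocus ((F.sup I : Ideal (MvPolynomial σ k)) : Set (MvPolynomial σ k)) := by
  rw [← PrimeSpectrum.zeroLocus_iSup]
  congr 2
  refine le_antisymm (iSup_le fun j => ?_) (Finset.sup_le fun j _ => le_iSup I j)
  by_cases hj : j ∈ F
  · exact Finset.le_sup hj
  · rw [hF j hj]
    exact bot_le

/-- Outside `F` the cylinders are the whole space or empty. One empty cylinder makes both sides `⊤`;
otherwise only the finitely many indices in `F` matter. -/
theorem codim_iInter_eq_tsum [Finite σ] (hι : ∀ j, Function.Injective (ι j))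
    (hd : ∀ i j, i ≠ j → Disjoint (Set.range (ι i)) (Set.range (ι j)))
    (J : ∀ j, Ideal (MvPolynomial (T j) k))
    (hZ : ∀ j, Z j = PrimeSpectrum.zeroLocus (extendVars (ι j) (J j) : Set (MvPolynomial σ k)))
    (F : Finset ℕ) (hF : ∀ j ∉ F, J j = ⊥ ∨ J j = ⊤) :
    codim (⋂ j, Z j) = ∑' j, codim (Z j) := by
  simp only [hZ]
  by_cases htop : ∃ j, J j = ⊤
  · obtain ⟨j, hj⟩ := htop
    have h1 : codim (PrimeSpectrum.zeroLocus (extendVars (ι j) (J j) :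
        Set (MvPolynomial σ k))) = ⊤ := by
      rw [codim_zeroLocus, hj, extendVars, Ideal.map_top, Ideal.height_top]
    have h2 : ⋂ j, PrimeSpectrum.zeroLocus (extendVars (ι j) (J j) : Set (MvPolynomial σ k)) =
        PrimeSpectrum.zeroLocus ((⊤ : Ideal (MvPolynomial σ k)) : Set (MvPolynomial σ k)) := by
      rw [← PrimeSpectrum.zeroLocus_iSup]
      congr 2
      refine top_unique (le_trans ?_ (le_iSup _ j))
      rw [hj, extendVars, Ideal.map_top]
    rw [h2, codim_zeroLocus, Ideal.height_top]
    exact (tsum_eq_top_of_eq_top (fun j => codim (PrimeSpectrum.zeroLocus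
      (extendVars (ι j) (J j) : Set (MvPolynomial σ k)))) h1).symm
  · push Not at htop
    have hb : ∀ j ∉ F, extendVars (ι j) (J j) = ⊥ := fun j hj => by
      rw [(hF j hj).resolve_right (htop j), extendVars, Ideal.map_bot]
    rw [iInter_zeroLocus_eq_finset_sup hb, codim_zeroLocus, height_finset_sup_extendVars hι hd,
      tsum_eq_sum (s := F)]
    · simp only [codim_zeroLocus]
    · intro j hj
      rw [codim_zeroLocus, hb j hj, Ideal.height_bot]

theorem isIrreducible_iInter_iff (hι : ∀ j, Function.Injective (ι j))
    (hd : ∀ i j, i ≠ j → Disjoint (Set.range (ι i)) (Set.range (ι j)))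
    (J : ∀ j, Ideal (MvPolynomial (T j) k))
    (hJ : ∀ j, (J j).radical.IsPrime → IsPolynomialKernel k (J j).radical)
    (hZ : ∀ j, Z j = PrimeSpectrum.zeroLocus (extendVars (ι j) (J j) : Set (MvPolynomial σ k)))
    (F : Finset ℕ) (hF : ∀ j ∉ F, J j = ⊥ ∨ J j = ⊤) :
    IsIrreducible (⋂ j, Z j) ↔ ∀ j, IsIrreducible (Z j) := by
  by_cases htop : ∃ j, J j = ⊤
  · obtain ⟨j, hj⟩ := htop
    have h1 : Z j = ∅ := by
      rw [hZ, hj, extendVars, Ideal.map_top]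
      exact PrimeSpectrum.zeroLocus_empty_of_one_mem (Submodule.mem_top (R := MvPolynomial σ k))
    have h2 : ⋂ j, Z j = ∅ := Set.iInter_eq_empty_iff.mpr fun x => ⟨j, by simp [h1]⟩
    constructor
    · intro h
      exact absurd h2 h.nonempty.ne_empty
    · intro h
      exact absurd h1 (h j).nonempty.ne_empty
  · push Not at htop
    have hb : ∀ j ∉ F, extendVars (ι j) (J j) = ⊥ := fun j hj => by
      rw [(hF j hj).resolve_right (htop j), extendVars, Ideal.map_bot]
    simp only [hZ]
    rw [iInter_zeroLocus_eq_finset_sup hb, PrimeSpectrum.isIrreducible_zeroLocus_iff]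
    simp only [PrimeSpectrum.isIrreducible_zeroLocus_iff]
    constructor
    · intro h j
      by_cases hj : j ∈ F
      · exact radical_isPrime_of_finset_sup hι hd J h hj
      · rw [hb j hj, Ideal.isPrime_bot.isRadical.radical]
        exact Ideal.isPrime_bot
    · intro h
      exact radical_finset_sup_isPrime hι hd J hJ F fun j _ => h j

end Family

end GroebnerCell

namespace GroebnerCell

open MvPolynomial

/-! ### The monomial ideal and its numerical data -/

section MonomialIdeal

/-- The exponent of `x ^ i y ^ j`. -/
noncomputable def expo (i j : ℕ) : Fin 2 →₀ ℕ := Finsupp.single 0 i + Finsupp.single 1 j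

@[simp] theorem expo_zero (i j : ℕ) : expo i j 0 = i := by simp [expo]

@[simp] theorem expo_one (i j : ℕ) : expo i j 1 = j := by simp [expo]

theorem eq_expo (e : Fin 2 →₀ ℕ) : e = expo (e 0) (e 1) := by
  ext s
  fin_cases s <;> simp

theorem expo_le_iff {i j : ℕ} {e : Fin 2 →₀ ℕ} : expo i j ≤ e ↔ i ≤ e 0 ∧ j ≤ e 1 := by
  rw [Finsupp.le_def, Fin.forall_fin_two, expo_zero, expo_one]

theorem X_pow_mul_X_pow {R : Type*} [CommSemiring R] (i j : ℕ) :
    (X 0 : MvPolynomial (Fin 2) R) ^ i * X 1 ^ j = monomial (expo i j) 1 := by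
  rw [X_pow_eq_monomial, X_pow_eq_monomial, monomial_mul, one_mul, expo]

universe u

variable {k : Type u} [Field k] {E : Ideal (MvPolynomial (Fin 2) k)}

theorem IsMonomialIdeal.monomial_mem (hE : IsMonomialIdeal E) {f : MvPolynomial (Fin 2) k}
    (hf : f ∈ E) {e : Fin 2 →₀ ℕ} (he : e ∈ f.support) : monomial e (1 : k) ∈ E := by
  obtain ⟨s, rfl⟩ := hE
  rw [mem_ideal_span_monomial_image] at hf ⊢
  obtain ⟨e', he', hle⟩ := hf e he
  intro e'' h
  rw [mem_support_iff, coeff_monomial] at h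
  have : e = e'' := by
    by_contra hne
    exact h (if_neg hne)
  exact ⟨e', he', this ▸ hle⟩

/-- The class of `X s` in the finite quotient is a root of a monic polynomial. As `E` is monomial,
it contains each term of the resulting element, in particular the top power. -/
theorem IsMonomialIdeal.exists_X_pow_mem (hE : IsMonomialIdeal E)
    (hfin : Module.Finite k (MvPolynomial (Fin 2) k ⧸ E)) (s : Fin 2) :
    ∃ n, (X s : MvPolynomial (Fin 2) k) ^ n ∈ E := by
  obtain ⟨p, hp, hp0⟩ := Algebra.IsIntegral.isIntegral (R := k) (Ideal.Quotient.mk E (X s))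
  refine ⟨p.natDegree, ?_⟩
  have h1 : Polynomial.aeval (X s : MvPolynomial (Fin 2) k) p ∈ E := by
    rw [← Ideal.Quotient.eq_zero_iff_mem, ← hp0]
    exact (Polynomial.aeval_algHom_apply (Ideal.Quotient.mkₐ k E) (X s) p).symm
  rw [X_pow_eq_monomial]
  refine hE.monomial_mem h1 ?_
  rw [mem_support_iff, Polynomial.aeval_eq_sum_range, coeff_sum,
    Finset.sum_eq_single_of_mem p.natDegree (Finset.self_mem_range_succ _)]
  · rw [coeff_smul, X_pow_eq_monomial, coeff_monomial, if_pos rfl, hp.coeff_natDegree]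
    simp
  · intro n _ hn
    rw [coeff_smul, X_pow_eq_monomial, coeff_monomial, if_neg, smul_zero]
    intro h
    exact hn (by simpa using DFunLike.congr_fun h s)

theorem X_zero_pow_tOf_mem (hE : IsMonomialIdeal E)
    (hfin : Module.Finite k (MvPolynomial (Fin 2) k ⧸ E)) :
    (X 0 : MvPolynomial (Fin 2) k) ^ tOf E ∈ E :=
  Nat.sInf_mem (hE.exists_X_pow_mem hfin 0)

theorem mOf_mem (hE : IsMonomialIdeal E)
    (hfin : Module.Finite k (MvPolynomial (Fin 2) k ⧸ E)) (i : ℕ) :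
    (X 0 : MvPolynomial (Fin 2) k) ^ (tOf E - i) * X 1 ^ mOf E i ∈ E := by
  refine Nat.sInf_mem (s := {j | (X 0 : MvPolynomial (Fin 2) k) ^ (tOf E - i) * X 1 ^ j ∈ E}) ?_
  obtain ⟨n, hn⟩ := hE.exists_X_pow_mem hfin 1
  exact ⟨n, E.mul_mem_left _ hn⟩

theorem mOf_le {i j : ℕ} (h : (X 0 : MvPolynomial (Fin 2) k) ^ (tOf E - i) * X 1 ^ j ∈ E) :
    mOf E i ≤ j :=
  Nat.sInf_le h

theorem mOf_zero (hE : IsMonomialIdeal E)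
    (hfin : Module.Finite k (MvPolynomial (Fin 2) k ⧸ E)) : mOf E 0 = 0 := by
  refine Nat.le_zero.mp (mOf_le ?_)
  simpa using X_zero_pow_tOf_mem hE hfin

theorem mOf_monotone (hE : IsMonomialIdeal E)
    (hfin : Module.Finite k (MvPolynomial (Fin 2) k ⧸ E)) : Monotone (mOf E) := by
  intro i j hij
  refine mOf_le ?_
  have h : tOf E - i = (tOf E - i - (tOf E - j)) + (tOf E - j) := by omega
  rw [h, pow_add, mul_assoc]
  exact E.mul_mem_left _ (mOf_mem hE hfin j)

/-- `E` is generated by the monomials `x ^ (t - i) y ^ m_i`. -/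
theorem eq_span_monomial (hE : IsMonomialIdeal E)
    (hfin : Module.Finite k (MvPolynomial (Fin 2) k ⧸ E)) :
    E = Ideal.span (Set.range fun r : Fin (tOf E + 1) =>
      monomial (expo (tOf E - r) (mOf E r)) (1 : k)) := by
  apply le_antisymm
  · have h0 := hE
    obtain ⟨s, hs⟩ := hE
    conv_lhs => rw [hs]
    rw [Ideal.span_le]
    rintro _ ⟨e, he, rfl⟩
    have hmem : monomial e (1 : k) ∈ E := by
      rw [hs]
      exact Ideal.subset_span ⟨e, he, rfl⟩
    have key : ∃ r : Fin (tOf E + 1), expo (tOf E - r) (mOf E r) ≤ e := by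
      -- A monomial of `x`-degree at least `t` is a multiple of `x^t`; any other is a multiple of
      -- the generator of the same `x`-degree.
      by_cases h : tOf E ≤ e 0
      · refine ⟨0, ?_⟩
        rw [expo_le_iff, Fin.val_zero, mOf_zero h0 hfin]
        exact ⟨by omega, Nat.zero_le _⟩
      · refine ⟨⟨tOf E - e 0, by omega⟩, ?_⟩
        rw [expo_le_iff]
        refine ⟨by simp only; omega, mOf_le ?_⟩
        have h1 : tOf E - (tOf E - e 0) = e 0 := by omega
        simp only [h1]
        rw [X_pow_mul_X_pow, ← eq_expo]
        exact hmem
    obtain ⟨r, hr⟩ := key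
    have h1 : monomial e (1 : k) = monomial (e - expo (tOf E - r) (mOf E r)) 1 *
        monomial (expo (tOf E - r) (mOf E r)) 1 := by
      rw [monomial_mul, one_mul, tsub_add_cancel_of_le hr]
    change monomial e (1 : k) ∈ Ideal.span _
    rw [h1]
    exact Ideal.mul_mem_left _ _ (Ideal.subset_span ⟨r, rfl⟩)
  · rw [Ideal.span_le]
    rintro _ ⟨r, rfl⟩
    simp only
    rw [← X_pow_mul_X_pow]
    exact mOf_mem hE hfin r

theorem extend_eq_span_monomial (hE : IsMonomialIdeal E)
    (hfin : Module.Finite k (MvPolynomial (Fin 2) k ⧸ E)) (K : Type u) [Field K] [Algebra k K] :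
    extend E K = Ideal.span (Set.range fun r : Fin (tOf E + 1) =>
      monomial (expo (tOf E - r) (mOf E r)) (1 : K)) := by
  rw [extend]
  conv_lhs => rw [eq_span_monomial hE hfin]
  rw [Ideal.map_span, ← Set.range_comp]
  congr 2
  ext1 r
  simp

/-- The minor of row `r` has degree `a_r` and column `c` is a syzygy of degree `b_c`, so `u` is the
degree of the entry `(r, c)`. -/
theorem uOf_eq (r : Fin (tOf E + 1)) (c : Fin (tOf E)) :
    uOf E r c = (bOf E c : ℤ) - aOf E r := by
  have h1 := r.2
  have h2 := c.2
  simp only [uOf, bOf, aOf, Fin.val_succ]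
  push_cast
  omega

end MonomialIdeal

end GroebnerCell

namespace GroebnerCell

open MvPolynomial

/-! ### Leading exponents of the maximal minors -/

section LexOrder

variable {K : Type*} [Field K]

theorem lex_lt_of_lt {e e' : Fin 2 →₀ ℕ} (h : e 0 < e' 0) :
    MonomialOrder.lex.toSyn e < MonomialOrder.lex.toSyn e' := by
  rw [MonomialOrder.lex_lt_iff, Finsupp.Lex.lt_iff]
  exact ⟨0, fun j hj => absurd hj (by simp), h⟩

theorem le_degree_zero {f : MvPolynomial (Fin 2) K} {e : Fin 2 →₀ ℕ} (he : e ∈ f.support) :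
    e 0 ≤ MonomialOrder.lex.degree f 0 := by
  by_contra! h
  exact absurd (MonomialOrder.lex.le_degree he) (not_le.mpr (lex_lt_of_lt h))

theorem degree_X_zero_mul_add {f g : MvPolynomial (Fin 2) K} (hf : f ≠ 0)
    (hg : ∀ e ∈ g.support, e 0 ≤ MonomialOrder.lex.degree f 0) :
    MonomialOrder.lex.degree (X 0 * f + g) = Finsupp.single 0 1 + MonomialOrder.lex.degree f ∧
      X 0 * f + g ≠ 0 := by
  have h1 : MonomialOrder.lex.degree (X 0 * f) =
      Finsupp.single 0 1 + MonomialOrder.lex.degree f := by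
    rw [MonomialOrder.degree_mul (X_ne_zero 0) hf, MonomialOrder.degree_X]
  have hlt : MonomialOrder.lex.toSyn (MonomialOrder.lex.degree g) <
      MonomialOrder.lex.toSyn (MonomialOrder.lex.degree (X 0 * f)) := by
    refine lex_lt_of_lt ?_
    rw [h1, Finsupp.add_apply, Finsupp.single_eq_same]
    by_cases hg0 : g = 0
    · rw [hg0, MonomialOrder.degree_zero, Finsupp.zero_apply]
      omega
    · have := hg _ (MonomialOrder.lex.degree_mem_support hg0)
      omega
  have h2 := MonomialOrder.degree_add_of_lt hlt
  refine ⟨h2.trans h1, MonomialOrder.ne_zero_of_degree_ne_zero (m := MonomialOrder.lex) ?_⟩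
  rw [h2, h1]
  intro h
  have := DFunLike.congr_fun h 0
  simp at this

end LexOrder

/-- The shape of the Hilbert-Burch matrices `M(p)`. -/
structure IsHilbertBurchShape {K : Type*} [Field K] {t : ℕ} (m : ℕ → ℕ)
    (M : Matrix (Fin (t + 1)) (Fin t) (MvPolynomial (Fin 2) K)) : Prop where
  zero : m 0 = 0
  mono : Monotone m
  upper : ∀ (r : Fin (t + 1)) (c : Fin t), (r : ℕ) < c → M r c = 0
  diag : ∀ c : Fin t, M c.castSucc c = X 1 ^ (m (c + 1) - m c)
  lower : ∀ (r : Fin (t + 1)) (c : Fin t), (c : ℕ) < r → ∃ (z : K) (n : ℕ),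
    (z ≠ 0 → n + (t - r + m r) = t - c + m (c + 1)) ∧
      M r c = (if (r : ℕ) = c + 1 then - X 0 else 0) + C z * X 1 ^ n

section SignedMinors

variable {R : Type*} [CommRing R] {t : ℕ} (M : Matrix (Fin (t + 1)) (Fin t) R)

/-- The maximal minors of a matrix with one more row than columns, with signs. -/
def signedMinor (r : Fin (t + 1)) : R :=
  (-1) ^ (r : ℕ) * (M.submatrix r.succAbove id).det

/-- Repeating column `c` in front gives a square matrix with two equal columns. Its Laplace
expansion along the first column is the relation. -/
theorem sum_mul_signedMinor (c : Fin t) : ∑ r, M r c * signedMinor M r = 0 := by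
  let N : Matrix (Fin (t + 1)) (Fin (t + 1)) R := fun r => Fin.cons (M r c) (M r)
  have h1 : N.det = 0 := by
    refine Matrix.det_zero_of_column_eq (Fin.succ_ne_zero c).symm fun r => ?_
    rfl
  rw [Matrix.det_succ_column_zero] at h1
  rw [← h1]
  refine Finset.sum_congr rfl fun r _ => ?_
  have h2 : N.submatrix r.succAbove Fin.succ = M.submatrix r.succAbove id := rfl
  have h3 : N r 0 = M r c := rfl
  rw [h2, h3, signedMinor]
  ring

theorem span_range_signedMinor :
    Ideal.span (Set.range (signedMinor M)) =
      Ideal.span (Set.range fun r : Fin (t + 1) => (M.submatrix r.succAbove id).det) := by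
  apply le_antisymm
  · rw [Ideal.span_le]
    rintro _ ⟨r, rfl⟩
    exact Ideal.mul_mem_left _ _ (Ideal.subset_span ⟨r, rfl⟩)
  · rw [Ideal.span_le]
    rintro _ ⟨r, rfl⟩
    have h : (M.submatrix r.succAbove id).det = (-1) ^ (r : ℕ) * signedMinor M r := by
      rw [signedMinor, ← mul_assoc, ← mul_pow]
      simp
    change (M.submatrix r.succAbove id).det ∈ Ideal.span _
    rw [h]
    exact Ideal.mul_mem_left _ _ (Ideal.subset_span ⟨r, rfl⟩)

end SignedMinors

namespace IsHilbertBurchShape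

variable {K : Type*} [Field K] {t : ℕ} {m : ℕ → ℕ}
  {M : Matrix (Fin (t + 1)) (Fin t) (MvPolynomial (Fin 2) K)}

theorem sum_sub_eq (h0 : m 0 = 0) (hm : Monotone m) (n : ℕ) :
    ∑ c : Fin n, (m (c + 1) - m c) = m n := by
  rw [Fin.sum_univ_eq_sum_range (fun c => m (c + 1) - m c), Finset.sum_range_tsub hm, h0]
  simp

theorem signedMinor_last (h : IsHilbertBurchShape m M) :
    signedMinor M (Fin.last t) = (-1) ^ t * X 1 ^ m t := by
  rw [signedMinor, Fin.val_last, Matrix.det_of_isLowerTriangular]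
  · simp only [Matrix.submatrix_apply, Fin.succAbove_last, id, h.diag, Finset.prod_pow_eq_pow_sum,
      sum_sub_eq h.zero h.mono]
  · intro i j hij
    rw [Matrix.submatrix_apply, Fin.succAbove_last]
    exact h.upper _ _ hij

/-- The relation that expresses the minor of index `c` through those of higher index. -/
theorem exists_X_pow_mul_signedMinor (h : IsHilbertBurchShape m M) (c : Fin t) :
    ∃ (z : Fin (t + 1) → K) (n : Fin (t + 1) → ℕ),
      (∀ r : Fin (t + 1), (c : ℕ) < r → z r ≠ 0 → n r + (t - r + m r) = t - c + m (c + 1)) ∧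
      X 1 ^ (m (c + 1) - m c) * signedMinor M c.castSucc = X 0 * signedMinor M c.succ +
        ∑ r with c.castSucc < r, -(C (z r) * X 1 ^ n r * signedMinor M r) := by
  classical
  have hl : ∀ r : Fin (t + 1), ∃ (z : K) (n : ℕ), (c : ℕ) < r →
      (z ≠ 0 → n + (t - r + m r) = t - c + m (c + 1)) ∧
        M r c = (if (r : ℕ) = c + 1 then - X 0 else 0) + C z * X 1 ^ n := by
    intro r
    by_cases hr : (c : ℕ) < r
    · obtain ⟨z, n, hzn⟩ := h.lower r c hr
      exact ⟨z, n, fun _ => hzn⟩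
    · exact ⟨0, 0, fun h' => absurd h' hr⟩
  choose z n hzn using hl
  refine ⟨z, n, fun r hr => ((hzn r) hr).1, ?_⟩
  have hs := sum_mul_signedMinor M c
  rw [← Finset.sum_filter_add_sum_filter_not Finset.univ (fun r => c.castSucc < r)] at hs
  have h1 : ∑ r with ¬ c.castSucc < r, M r c * signedMinor M r =
      X 1 ^ (m (c + 1) - m c) * signedMinor M c.castSucc := by
    rw [Finset.sum_eq_single_of_mem c.castSucc (by simp), h.diag]
    intro r hr hrc
    rw [h.upper, zero_mul]
    simp only [Finset.mem_filter, Finset.mem_univ, true_and, not_lt] at hr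
    exact lt_of_le_of_ne hr (fun h' => hrc (Fin.ext h'))
  have h2 : ∑ r with c.castSucc < r, M r c * signedMinor M r =
      - (X 0 * signedMinor M c.succ) +
        ∑ r with c.castSucc < r, C (z r) * X 1 ^ n r * signedMinor M r := by
    have h3 : ∀ r ∈ Finset.univ.filter (fun r => c.castSucc < r), M r c * signedMinor M r =
        (if r = c.succ then -(X 0 * signedMinor M r) else 0) +
          C (z r) * X 1 ^ n r * signedMinor M r := by
      intro r hr
      simp only [Finset.mem_filter, Finset.mem_univ, true_and] at hr
      rw [(hzn r hr).2, add_mul, ite_mul, zero_mul, neg_mul]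
      simp only [Fin.ext_iff, Fin.val_succ]
    rw [Finset.sum_congr rfl h3, Finset.sum_add_distrib, Finset.sum_ite_eq',
      if_pos (by simp)]
  rw [h1, h2] at hs
  rw [Finset.sum_neg_distrib]
  linear_combination hs

/-- The leading exponent of the minor of index `r` is that of `x ^ (t - r) y ^ m_r`. -/
theorem signedMinor_spec (h : IsHilbertBurchShape m M) (r : Fin (t + 1)) :
    signedMinor M r ≠ 0 ∧
      MonomialOrder.lex.degree (signedMinor M r) = expo (t - r) (m r) ∧
      (X 1 : MvPolynomial (Fin 2) K) ^ m r ∣ signedMinor M r ∧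
      (signedMinor M r).IsHomogeneous (t - r + m r) := by
  obtain ⟨n, hn⟩ : ∃ n, t - (r : ℕ) = n := ⟨_, rfl⟩
  -- Descending induction on `r`, starting from the last minor, which is a power of `y` up to sign.
  induction n using Nat.strong_induction_on generalizing r with
  | _ n ih =>
    rcases r.eq_castSucc_or_eq_last with ⟨c, rfl⟩ | rfl
    · obtain ⟨z, e, hze, heq⟩ := h.exists_X_pow_mul_signedMinor c
      have hc := c.2
      rw [Fin.val_castSucc] at hn
      have ih' : ∀ r : Fin (t + 1), c.castSucc < r → _ := fun r hr => ih (t - r) (by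
        have : (c : ℕ) < r := hr
        have := r.2
        omega) r rfl
      obtain ⟨hs0, hsd, hsv, hsh⟩ := ih' c.succ Fin.castSucc_lt_succ
      set rest := ∑ r with c.castSucc < r, -(C (z r) * X 1 ^ e r * signedMinor M r) with hrest
      have hmc : m c ≤ m (c + 1) := h.mono (Nat.le_succ _)
      -- Multiplication by powers of `y` does not change `x`-degrees, and `F_r` with `r > c` has
      -- `x`-degree `t - r ≤ t - (c + 1)`. So `x F_(c+1)` dominates the relation.
      have hsupp : ∀ e ∈ rest.support, e 0 ≤ MonomialOrder.lex.degree (signedMinor M c.succ) 0 := by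
        intro e' he'
        obtain ⟨r, hr, her⟩ := Finset.mem_biUnion.mp (support_sum he')
        simp only [Finset.mem_filter, Finset.mem_univ, true_and] at hr
        have hterm : -(C (z r) * X 1 ^ e r * signedMinor M r) =
            monomial (Finsupp.single 1 (e r)) (-z r) * signedMinor M r := by
          rw [X_pow_eq_monomial, C_mul_monomial, mul_one, ← neg_mul, map_neg]
        rw [hterm, mem_support_iff, coeff_monomial_mul'] at her
        split_ifs at her with hle
        · have h1 := le_degree_zero (mem_support_iff.mpr (right_ne_zero_of_mul her))
          rw [(ih' r hr).2.1] at h1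
          rw [hsd]
          simp only [Finsupp.tsub_apply, expo_zero, Fin.val_succ] at h1 ⊢
          have h2 : (Finsupp.single 1 (e r) : Fin 2 →₀ ℕ) 0 = 0 := by simp
          have h3 : (c : ℕ) < r := hr
          omega
        · exact absurd rfl her
      obtain ⟨hd, hne⟩ := degree_X_zero_mul_add hs0 hsupp
      rw [← heq] at hd hne
      have hF : signedMinor M c.castSucc ≠ 0 := right_ne_zero_of_mul hne
      have hdeg : MonomialOrder.lex.degree (signedMinor M c.castSucc) = expo (t - c) (m c) := by
        rw [MonomialOrder.degree_mul (left_ne_zero_of_mul hne) hF, MonomialOrder.degree_pow,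
          MonomialOrder.degree_X, hsd] at hd
        have h0 := DFunLike.congr_fun hd 0
        have h1 := DFunLike.congr_fun hd 1
        simp at h0 h1
        rw [eq_expo (MonomialOrder.lex.degree (signedMinor M c.castSucc))]
        congr 1 <;> omega
      refine ⟨hF, hdeg, ?_, ?_⟩
      · have h1 : (X 1 : MvPolynomial (Fin 2) K) ^ m (c + 1) ∣
            X 0 * signedMinor M c.succ + rest := by
          refine dvd_add (hsv.mul_left _) (Finset.dvd_sum fun r hr => ?_)
          simp only [Finset.mem_filter, Finset.mem_univ, true_and] at hr
          rw [dvd_neg]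
          exact ((pow_dvd_pow _ (h.mono (show (c : ℕ) + 1 ≤ r from hr))).trans
            (ih' r hr).2.2.1).mul_left _
        have h2 : m (c + 1) = (m (c + 1) - m c) + m c := by omega
        rw [← heq, h2, pow_add, Nat.add_sub_cancel] at h1
        exact (mul_dvd_mul_iff_left (pow_ne_zero _ (X_ne_zero 1))).mp h1
      · have h1 : (X 0 * signedMinor M c.succ + rest).IsHomogeneous (t - c + m (c + 1)) := by
          refine IsHomogeneous.add ?_ (IsHomogeneous.sum _ _ _ fun r hr => ?_)
          · have h2 := (isHomogeneous_X K (0 : Fin 2)).mul hsh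
            have h3 : 1 + (t - (c.succ : ℕ) + m c.succ) = t - c + m (c + 1) := by
              rw [Fin.val_succ]
              omega
            rwa [h3] at h2
          · simp only [Finset.mem_filter, Finset.mem_univ, true_and] at hr
            refine IsHomogeneous.neg ?_
            by_cases hz : z r = 0
            · rw [hz, C_0, zero_mul, zero_mul]
              exact isHomogeneous_zero _ _ _
            · rw [← hze r hr hz, mul_assoc]
              exact ((isHomogeneous_X_pow 1 (e r)).mul (ih' r hr).2.2.2).C_mul _
        rw [← heq] at h1
        intro e' he'
        have h2 := h1 (d := Finsupp.single 1 (m (c + 1) - m c) + e') (by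
          rwa [X_pow_eq_monomial, coeff_monomial_mul, one_mul])
        rw [map_add, Finsupp.weight_single] at h2
        simp only [Pi.one_apply, smul_eq_mul, mul_one] at h2
        rw [Fin.val_castSucc]
        omega
    · rw [h.signedMinor_last, Fin.val_last, Nat.sub_self]
      refine ⟨by simp, ?_, Dvd.intro_left _ rfl, ?_⟩
      · have h1 : ((-1) ^ t * X 1 ^ m t : MvPolynomial (Fin 2) K) =
            monomial (expo 0 (m t)) ((-1) ^ t) := by
          rw [X_pow_eq_monomial, expo, Finsupp.single_zero, zero_add]
          have h2 : ((-1) ^ t : MvPolynomial (Fin 2) K) = C ((-1) ^ t) := by simp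
          rw [h2, C_mul_monomial, mul_one]
        classical
        rw [h1, MonomialOrder.degree_monomial, if_neg (by simp)]
      · have h2 : ((-1) ^ t : MvPolynomial (Fin 2) K) = C ((-1) ^ t) := by simp
        rw [h2, zero_add]
        exact (isHomogeneous_X_pow 1 (m t)).C_mul _

end IsHilbertBurchShape

end GroebnerCell

namespace GroebnerCell

open MvPolynomial Matrix

/-! ### Reduction modulo the columns, syzygies and the leading term ideal -/

namespace IsHilbertBurchShape

variable {K : Type*} [Field K] {t : ℕ} {m : ℕ → ℕ}
  {M : Matrix (Fin (t + 1)) (Fin t) (MvPolynomial (Fin 2) K)}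

/-- The entry `c` of `g` has `y`-degree less than `d_{c+1}`, for all `c < t`. -/
def IsReducedVector (m : ℕ → ℕ) (g : Fin (t + 1) → MvPolynomial (Fin 2) K) : Prop :=
  ∀ c : Fin t, ∀ e ∈ (g c.castSucc).support, e 1 < m (c + 1) - m c

/-- The entries are divided by the diagonal powers of `y` from top to bottom. Column `c` vanishes
above the diagonal, so the entries treated earlier do not change. -/
theorem exists_isReducedVector (h : IsHilbertBurchShape m M)
    (g : Fin (t + 1) → MvPolynomial (Fin 2) K) :
    ∃ q, IsReducedVector m (g - M *ᵥ q) := by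
  suffices H : ∀ n ≤ t, ∃ q, ∀ c : Fin t, (c : ℕ) < n →
      ∀ e ∈ ((g - M *ᵥ q) c.castSucc).support, e 1 < m (c + 1) - m c by
    obtain ⟨q, hq⟩ := H t le_rfl
    exact ⟨q, fun c => hq c c.2⟩
  intro n
  induction n with
  | zero => exact fun _ => ⟨0, fun c hc => absurd hc (Nat.not_lt_zero _)⟩
  | succ n ih =>
    intro hn
    obtain ⟨q, hq⟩ := ih (by omega)
    let c₀ : Fin t := ⟨n, by omega⟩
    let s : Fin 2 →₀ ℕ := Finsupp.single 1 (m (c₀ + 1) - m c₀)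
    let w := ((g - M *ᵥ q) c₀.castSucc).divMonomial s
    have key : ∀ r, (g - M *ᵥ (q + Pi.single c₀ w)) r = (g - M *ᵥ q) r - M r c₀ * w := by
      intro r
      rw [mulVec_add, ← sub_sub, Pi.sub_apply _ (M *ᵥ Pi.single c₀ w), mulVec_single]
      rfl
    refine ⟨q + Pi.single c₀ w, fun c hc e he => ?_⟩
    rw [key] at he
    rcases Nat.lt_succ_iff_lt_or_eq.mp hc with hlt | heq
    · rw [h.upper _ _ (show (c.castSucc : ℕ) < c₀ from hlt), zero_mul, sub_zero] at he
      exact hq c hlt e he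
    · obtain rfl : c = c₀ := Fin.ext heq
      have h1 := modMonomial_add_divMonomial ((g - M *ᵥ q) c₀.castSucc) s
      rw [h.diag, X_pow_eq_monomial] at he
      rw [← eq_sub_iff_add_eq] at h1
      rw [← h1, mem_support_iff] at he
      by_contra hlt
      refine he (coeff_modMonomial_of_le _ ?_)
      rw [Finsupp.single_le_iff]
      omega

/-- The leading exponent of a nonzero combination of the minors with reduced coefficients is
divisible by the leading exponent of one of the minors. -/
theorem degree_sum_of_isReducedVector (h : IsHilbertBurchShape m M)
    {g : Fin (t + 1) → MvPolynomial (Fin 2) K} (hg : IsReducedVector m g) (hg0 : g ≠ 0) :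
    ∑ r, g r * signedMinor M r ≠ 0 ∧ ∃ r : Fin (t + 1), expo (t - r) (m r) ≤
      MonomialOrder.lex.degree (∑ r, g r * signedMinor M r) := by
  -- The sum is built from the last index downwards. The invariant is that a tail starting at `r`,
  -- unless all its coefficients vanish, has leading `y`-exponent at least `m_r`.
  suffices H : ∀ n ≤ t + 1, (∀ r : Fin (t + 1), t + 1 - n ≤ r → g r = 0) ∨
      (∑ r ∈ Finset.univ.filter (fun r : Fin (t + 1) => t + 1 - n ≤ r), g r * signedMinor M r ≠ 0 ∧
        m (t + 1 - n) ≤ MonomialOrder.lex.degree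
          (∑ r ∈ Finset.univ.filter (fun r : Fin (t + 1) => t + 1 - n ≤ r),
            g r * signedMinor M r) 1 ∧
        ∃ r : Fin (t + 1), expo (t - r) (m r) ≤ MonomialOrder.lex.degree
          (∑ r ∈ Finset.univ.filter (fun r : Fin (t + 1) => t + 1 - n ≤ r),
            g r * signedMinor M r)) by
    rcases H (t + 1) le_rfl with h1 | ⟨h1, -, h2⟩
    · exact absurd (funext fun r => h1 r (by omega)) hg0
    · simpa using And.intro h1 h2
  intro n
  induction n with
  | zero =>
    intro _
    left
    intro r hr
    have := r.2
    omega
  | succ n ih =>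
    intro hn
    obtain ⟨r₀, hr₀⟩ : ∃ r₀ : Fin (t + 1), t + 1 - (n + 1) = (r₀ : ℕ) :=
      ⟨⟨t + 1 - (n + 1), by omega⟩, rfl⟩
    have hn' : t + 1 - n = r₀ + 1 := by omega
    have ih := ih (by omega)
    rw [hn'] at ih
    rw [hr₀]
    have hmr : m r₀ ≤ m (r₀ + 1) := h.mono (Nat.le_succ _)
    set S := ∑ r ∈ Finset.univ.filter (fun r : Fin (t + 1) => (r₀ : ℕ) + 1 ≤ r),
      g r * signedMinor M r with hS
    have hsum : ∑ r ∈ Finset.univ.filter (fun r : Fin (t + 1) => (r₀ : ℕ) ≤ r),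
        g r * signedMinor M r =
        g r₀ * signedMinor M r₀ + S := by
      have : Finset.univ.filter (fun r : Fin (t + 1) => (r₀ : ℕ) ≤ r) =
          insert r₀ (Finset.univ.filter (fun r : Fin (t + 1) => (r₀ : ℕ) + 1 ≤ r)) := by
        ext r
        simp only [Finset.mem_filter, Finset.mem_univ, true_and, Finset.mem_insert, Fin.ext_iff]
        omega
      rw [this, Finset.sum_insert (by simp)]
    rw [hsum]
    by_cases h0 : g r₀ = 0
    · rw [h0, zero_mul, zero_add]
      rcases ih with ih | ⟨h1, h2, h3⟩
      · left
        intro r hr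
        rcases hr.eq_or_lt with h' | h'
        · rw [← Fin.ext h', h0]
        · exact ih r h'
      · exact Or.inr ⟨h1, hmr.trans h2, h3⟩
    · right
      obtain ⟨hF, hFd, -, -⟩ := h.signedMinor_spec r₀
      have hp : g r₀ * signedMinor M r₀ ≠ 0 := mul_ne_zero h0 hF
      have hpd : MonomialOrder.lex.degree (g r₀ * signedMinor M r₀) =
          MonomialOrder.lex.degree (g r₀) + expo (t - r₀) (m r₀) := by
        rw [MonomialOrder.degree_mul h0 hF, hFd]
      have hD1 : m r₀ ≤ MonomialOrder.lex.degree (g r₀ * signedMinor M r₀) 1 := by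
        rw [hpd, Finsupp.add_apply, expo_one]
        omega
      have hD2 : expo (t - r₀) (m r₀) ≤
          MonomialOrder.lex.degree (g r₀ * signedMinor M r₀) := by
        rw [hpd]
        exact le_add_self
      rcases ih with ih | ⟨h1, h2, h3⟩
      · have hS0 : S = 0 := Finset.sum_eq_zero fun r hr => by
          rw [ih r (by simpa using hr), zero_mul]
        rw [hS0, add_zero]
        exact ⟨hp, hD1, r₀, hD2⟩
      · have hlast : (r₀ : ℕ) < t := by
          by_contra hlt
          refine h1 (Finset.sum_eq_zero fun r hr => ?_)
          have := r.2
          simp only [Finset.mem_filter, Finset.mem_univ, true_and] at hr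
          omega
        have hred := hg ⟨r₀, hlast⟩ _ (MonomialOrder.lex.degree_mem_support h0)
        -- Reducedness keeps the leading `y`-exponent of the new term below `m (r₀ + 1)`, whereas
        -- that of the tail is at least `m (r₀ + 1)`.
        have hne : MonomialOrder.lex.degree (g r₀ * signedMinor M r₀) ≠
            MonomialOrder.lex.degree S := by
          intro heq
          rw [← heq, hpd, Finsupp.add_apply, expo_one] at h2
          rw [show (⟨r₀, hlast⟩ : Fin t).castSucc = r₀ from rfl] at hred
          simp only at hred
          omega
        have hadd := MonomialOrder.degree_add_of_ne hne
        have hcases : MonomialOrder.lex.degree (g r₀ * signedMinor M r₀ + S) =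
            MonomialOrder.lex.degree (g r₀ * signedMinor M r₀) ∨
            MonomialOrder.lex.degree (g r₀ * signedMinor M r₀ + S) =
            MonomialOrder.lex.degree S := by
          rcases le_total (MonomialOrder.lex.toSyn (MonomialOrder.lex.degree
            (g r₀ * signedMinor M r₀))) (MonomialOrder.lex.toSyn
              (MonomialOrder.lex.degree S)) with hle | hle
          · rw [sup_eq_right.mpr hle] at hadd
            exact Or.inr (MonomialOrder.lex.toSyn.injective hadd)
          · rw [sup_eq_left.mpr hle] at hadd
            exact Or.inl (MonomialOrder.lex.toSyn.injective hadd)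
        refine ⟨fun hzero => hne ?_, ?_⟩
        · rw [eq_neg_of_add_eq_zero_left hzero, MonomialOrder.degree_neg]
        · rcases hcases with hc | hc <;> rw [hc]
          · exact ⟨hD1, r₀, hD2⟩
          · exact ⟨hmr.trans h2, h3⟩

theorem sum_mulVec_mul_signedMinor (q : Fin t → MvPolynomial (Fin 2) K) :
    ∑ r, (M *ᵥ q) r * signedMinor M r = 0 := by
  simp only [mulVec, dotProduct, Finset.sum_mul]
  rw [Finset.sum_comm]
  refine Finset.sum_eq_zero fun c _ => ?_
  have : ∀ r, M r c * q c * signedMinor M r = q c * (M r c * signedMinor M r) := fun r => by ring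
  rw [Finset.sum_congr rfl fun r _ => this r, ← Finset.mul_sum, sum_mul_signedMinor, mul_zero]

/-- The syzygies of the minors are the combinations of the columns of the matrix. -/
theorem exists_mulVec_eq_of_sum_eq_zero (h : IsHilbertBurchShape m M)
    {g : Fin (t + 1) → MvPolynomial (Fin 2) K} (hg : ∑ r, g r * signedMinor M r = 0) :
    ∃ q, g = M *ᵥ q := by
  obtain ⟨q, hq⟩ := h.exists_isReducedVector g
  refine ⟨q, ?_⟩
  by_contra hne
  refine (h.degree_sum_of_isReducedVector hq (sub_ne_zero.mpr hne)).1 ?_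
  simp only [Pi.sub_apply, sub_mul, Finset.sum_sub_distrib, hg, sum_mulVec_mul_signedMinor,
    sub_zero]

theorem mem_span_signedMinor_iff {f : MvPolynomial (Fin 2) K} :
    f ∈ Ideal.span (Set.range (signedMinor M)) ↔
      ∃ g : Fin (t + 1) → MvPolynomial (Fin 2) K, ∑ r, g r * signedMinor M r = f :=
  Ideal.mem_span_range_iff_exists_fun

/-- The leading term ideal of the ideal of maximal minors. -/
theorem leadingTermIdeal_eq (h : IsHilbertBurchShape m M) :
    leadingTermIdeal (Ideal.span (Set.range (signedMinor M))) =
      Ideal.span (Set.range fun r : Fin (t + 1) => monomial (expo (t - r) (m r)) (1 : K)) := by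
  apply le_antisymm
  · rw [leadingTermIdeal, Ideal.span_le]
    rintro _ ⟨f, hf, hf0, rfl⟩
    obtain ⟨g, rfl⟩ := mem_span_signedMinor_iff.mp hf
    obtain ⟨q, hq⟩ := h.exists_isReducedVector g
    have h1 : ∑ r, (g - M *ᵥ q) r * signedMinor M r = ∑ r, g r * signedMinor M r := by
      simp only [Pi.sub_apply, sub_mul, Finset.sum_sub_distrib, sum_mulVec_mul_signedMinor,
        sub_zero]
    have h2 : g - M *ᵥ q ≠ 0 := by
      intro h0
      rw [h0] at h1
      exact hf0 (by simpa using h1.symm)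
    obtain ⟨-, r, hr⟩ := h.degree_sum_of_isReducedVector hq h2
    rw [h1] at hr
    rw [SetLike.mem_coe, MonomialOrder.leadingTerm, ← tsub_add_cancel_of_le hr,
      ← mul_one (MonomialOrder.lex.leadingCoeff _), ← monomial_mul]
    exact Ideal.mul_mem_left _ _ (Ideal.subset_span ⟨r, rfl⟩)
  · rw [Ideal.span_le]
    rintro _ ⟨r, rfl⟩
    obtain ⟨hF, hFd, -, -⟩ := h.signedMinor_spec r
    have h1 : MonomialOrder.lex.leadingTerm (signedMinor M r) ∈
        leadingTermIdeal (Ideal.span (Set.range (signedMinor M))) :=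
      Ideal.subset_span ⟨_, Ideal.subset_span ⟨r, rfl⟩, hF, rfl⟩
    have h2 := Ideal.mul_mem_left _ (C (MonomialOrder.lex.leadingCoeff (signedMinor M r))⁻¹) h1
    rw [MonomialOrder.leadingTerm, hFd, C_mul_monomial,
      inv_mul_cancel₀ (MonomialOrder.leadingCoeff_ne_zero_iff.mpr hF)] at h2
    exact h2

end IsHilbertBurchShape

end GroebnerCell

namespace GroebnerCell

open MvPolynomial Matrix

universe u

/-! ### The matrices `M(p)` as Hilbert-Burch matrices -/

section Shape

variable {k : Type u} [Field k] {E : Ideal (MvPolynomial (Fin 2) k)}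

theorem bOf_eq (c : Fin (tOf E)) : bOf E c = tOf E - c + mOf E (c + 1) := by
  have := c.2
  simp only [bOf, aOf, Fin.val_succ]
  omega

theorem isHilbertBurchShape_hbMatrix (hE : IsMonomialIdeal E)
    (hfin : Module.Finite k (MvPolynomial (Fin 2) k ⧸ E)) {K : Type u} [Field K]
    (p : Param E → K) : IsHilbertBurchShape (mOf E) (hbMatrix E p) where
  zero := mOf_zero hE hfin
  mono := mOf_monotone hE hfin
  upper r c hrc := by
    rw [hbMatrix, Matrix.add_apply, baseMatrix, paramMatrix, if_neg (by omega), if_neg (by omega),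
      dif_neg (fun h => absurd h.1 (by omega)), add_zero]
  diag c := by
    rw [hbMatrix, Matrix.add_apply, baseMatrix, paramMatrix, if_pos (by simp),
      dif_neg (fun h => absurd h.1 (by simp)), add_zero, dOf]
  lower r c hrc := by
    by_cases h : (c : ℕ) < r ∧ 0 ≤ uOf E r c ∧ uOf E r c < dOf E c
    · refine ⟨p ⟨(r, c), h⟩, (uOf E r c).toNat, fun _ => ?_, ?_⟩
      · have h1 := uOf_eq (E := E) r c
        have h2 := bOf_eq (E := E) c
        have h3 : aOf E r = tOf E - r + mOf E r := rfl
        omega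
      · rw [hbMatrix, Matrix.add_apply, baseMatrix, paramMatrix, if_neg (by omega), dif_pos h]
    · refine ⟨0, 0, fun h0 => absurd rfl h0, ?_⟩
      rw [hbMatrix, Matrix.add_apply, baseMatrix, paramMatrix, if_neg (by omega), dif_neg h]
      simp

theorem hbIdeal_eq_span_signedMinor {K : Type u} [Field K] (p : Param E → K) :
    hbIdeal E p = Ideal.span (Set.range (signedMinor (hbMatrix E p))) :=
  (span_range_signedMinor _).symm

theorem isHomogeneous_signedMinor (hE : IsMonomialIdeal E)
    (hfin : Module.Finite k (MvPolynomial (Fin 2) k ⧸ E)) {K : Type u} [Field K]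
    (p : Param E → K) (r : Fin (tOf E + 1)) :
    (signedMinor (hbMatrix E p) r).IsHomogeneous (aOf E r) :=
  ((isHilbertBurchShape_hbMatrix hE hfin p).signedMinor_spec r).2.2.2

/-- The constant terms of the entries of `M(p)` vanish outside of the blocks `M(p)_j`. -/
theorem constantCoeff_hbMatrix_eq_zero (hE : IsMonomialIdeal E)
    (hfin : Module.Finite k (MvPolynomial (Fin 2) k ⧸ E)) {K : Type u} [Field K]
    (p : Param E → K) {r : Fin (tOf E + 1)} {c : Fin (tOf E)} (h : aOf E r ≠ bOf E c) :
    constantCoeff (hbMatrix E p r c) = 0 := by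
  have hs := isHilbertBurchShape_hbMatrix hE hfin p
  have h2 := bOf_eq (E := E) c
  have h3 : aOf E r = tOf E - r + mOf E r := rfl
  rcases lt_trichotomy (r : ℕ) c with hrc | hrc | hrc
  · rw [hs.upper r c hrc, map_zero]
  · obtain rfl : r = c.castSucc := Fin.ext hrc
    have hm := hs.mono (show (c : ℕ) ≤ c + 1 from Nat.le_succ _)
    rw [Fin.val_castSucc] at h3
    rw [hs.diag, map_pow, constantCoeff_X, zero_pow]
    omega
  · obtain ⟨z, n, hz, heq⟩ := hs.lower r c hrc
    rw [heq, map_add, map_mul, map_pow, constantCoeff_C, constantCoeff_X]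
    have h4 : constantCoeff
        (if (r : ℕ) = c + 1 then -(X 0 : MvPolynomial (Fin 2) K) else 0) = 0 := by
      split_ifs <;> simp
    rw [h4, zero_add]
    by_cases hz0 : z = 0
    · rw [hz0, zero_mul]
    · have := hz hz0
      rw [zero_pow (by omega), mul_zero]

end Shape

/-! ### Betti numbers as coranks of the blocks `M(p)_j` -/

section Betti

attribute [local instance] MvPolynomial.gradedAlgebra

variable {K : Type u} [Field K]

theorem mem_span_X_iff {f : MvPolynomial (Fin 2) K} :
    f ∈ Ideal.span {X 0, X 1} ↔ constantCoeff f = 0 := by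
  have h : ({X 0, X 1} : Set (MvPolynomial (Fin 2) K)) = X '' Set.univ := by
    ext g
    simp [Fin.exists_fin_two, eq_comm]
  rw [h, mem_ideal_span_X_image]
  constructor
  · intro hf
    by_contra h0
    rw [constantCoeff_eq] at h0
    obtain ⟨i, -, hi⟩ := hf 0 (mem_support_iff.mpr h0)
    exact hi rfl
  · intro hf e he
    by_contra! h0
    have : e = 0 := by
      ext i
      exact h0 i (Set.mem_univ i)
    rw [this, mem_support_iff] at he
    exact he hf

theorem isHomogeneous_span_X :
    (Ideal.span {X 0, X 1} : Ideal (MvPolynomial (Fin 2) K)).IsHomogeneous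
      (homogeneousSubmodule (Fin 2) K) := by
  refine Ideal.homogeneous_span _ _ ?_
  rintro x (rfl | rfl)
  · exact ⟨1, isHomogeneous_X K 0⟩
  · exact ⟨1, isHomogeneous_X K 1⟩

theorem homogeneousComponent_mem {I : Ideal (MvPolynomial (Fin 2) K)}
    (hI : I.IsHomogeneous (homogeneousSubmodule (Fin 2) K)) {f : MvPolynomial (Fin 2) K}
    (hf : f ∈ I) (j : ℕ) : homogeneousComponent j f ∈ I := by
  have := hI j hf
  rwa [← decomposition.decompose'_apply]

theorem mem_mul_span_range_iff {ι R : Type*} [CommRing R] [Fintype ι] {I : Ideal R} {F : ι → R}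
    {x : R} : x ∈ I * Ideal.span (Set.range F) ↔
      ∃ h : ι → R, (∀ i, h i ∈ I) ∧ ∑ i, h i * F i = x := by
  rw [← smul_eq_mul, Ideal.span, Submodule.mem_ideal_smul_span_iff_exists_sum]
  constructor
  · rintro ⟨a, ha, rfl⟩
    exact ⟨a, ha, (Finsupp.sum_fintype a (fun i c => c • F i) fun i => zero_smul _ _).symm⟩
  · rintro ⟨h, hh, rfl⟩
    refine ⟨Finsupp.equivFunOnFinite.symm h, hh, ?_⟩
    exact Finsupp.sum_fintype _ (fun i c => c • F i) fun i => zero_smul _ _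

variable {k : Type u} [Field k] {E : Ideal (MvPolynomial (Fin 2) k)}

theorem isHomogeneous_hbIdeal (hE : IsMonomialIdeal E)
    (hfin : Module.Finite k (MvPolynomial (Fin 2) k ⧸ E)) (p : Param E → K) :
    (hbIdeal E p).IsHomogeneous (homogeneousSubmodule (Fin 2) K) := by
  rw [hbIdeal_eq_span_signedMinor]
  refine Ideal.homogeneous_span _ _ ?_
  rintro _ ⟨r, rfl⟩
  exact ⟨_, isHomogeneous_signedMinor hE hfin p r⟩

theorem hbIdeal_mem_cell (hE : IsMonomialIdeal E)
    (hfin : Module.Finite k (MvPolynomial (Fin 2) k ⧸ E)) [Algebra k K] (p : Param E → K) :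
    hbIdeal E p ∈ cell (extend E K) := by
  refine ⟨isHomogeneous_hbIdeal hE hfin p, ?_⟩
  rw [hbIdeal_eq_span_signedMinor, (isHilbertBurchShape_hbMatrix hE hfin p).leadingTermIdeal_eq,
    extend_eq_span_monomial hE hfin]

theorem sum_eq_sum_subtype {ι M : Type*} [Fintype ι] [AddCommMonoid M] {P : ι → Prop}
    [DecidablePred P] {f : ι → M} (hf : ∀ i, ¬ P i → f i = 0) :
    ∑ i, f i = ∑ i : {i // P i}, f i := by
  rw [← Finset.sum_subtype (Finset.univ.filter P) (by simp) f]
  exact (Finset.sum_filter_of_ne fun i _ hi => by_contra fun h => hi (hf i h)).symm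

/-- Extension by zero of a vector indexed by the rows of degree `j`, as a vector of constants. -/
noncomputable def extendRows (j : ℕ) (v : Rows E j → K) :
    Fin (tOf E + 1) → MvPolynomial (Fin 2) K :=
  fun r => if h : aOf E r = j then C (v ⟨r, h⟩) else 0

theorem sum_extendRows_mul (j : ℕ) (v : Rows E j → K)
    (F : Fin (tOf E + 1) → MvPolynomial (Fin 2) K) :
    ∑ r, extendRows j v r * F r = ∑ r : Rows E j, v r • F r := by
  rw [sum_eq_sum_subtype (P := fun r => aOf E r = j) fun r hr => by
    rw [extendRows, dif_neg hr, zero_mul]]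
  refine Finset.sum_congr rfl fun r _ => ?_
  rw [extendRows, dif_pos r.2, smul_eq_C_mul]

/-- A combination of the minors of degree `j` with constant coefficients lies in `(x, y) I_p` if
and only if the vector of the coefficients lies in the image of `M(p)_j`. -/
theorem sum_smul_signedMinor_mem_iff (hE : IsMonomialIdeal E)
    (hfin : Module.Finite k (MvPolynomial (Fin 2) k ⧸ E)) (p : Param E → K) (j : ℕ)
    (v : Rows E j → K) :
    ∑ r : Rows E j, v r • signedMinor (hbMatrix E p) r ∈ Ideal.span {X 0, X 1} * hbIdeal E p ↔
      ∃ w, degreeMatrix E p j *ᵥ w = v := by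
  have hs := isHilbertBurchShape_hbMatrix hE hfin p
  rw [← sum_extendRows_mul, hbIdeal_eq_span_signedMinor, mem_mul_span_range_iff]
  constructor
  · rintro ⟨h, hh, heq⟩
    -- The difference of two expressions of the same element is a syzygy `M(p) q`. On the rows of
    -- degree `j` the constant terms of `h` vanish, and only the columns of degree `j` have nonzero
    -- constant terms.
    obtain ⟨q, hq⟩ := hs.exists_mulVec_eq_of_sum_eq_zero (g := extendRows j v - h) (by
      simp only [Pi.sub_apply, sub_mul, Finset.sum_sub_distrib, heq, sub_self])
    refine ⟨fun c => constantCoeff (q c), ?_⟩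
    ext r
    have h1 := congrArg constantCoeff (congrFun hq r)
    rw [Pi.sub_apply, map_sub, mem_span_X_iff.mp (hh r), sub_zero, extendRows, dif_pos r.2,
      constantCoeff_C] at h1
    have h2 : ∀ c, ¬ bOf E c = j → constantCoeff (hbMatrix E p r c * q c) = 0 := fun c hc => by
      rw [map_mul, constantCoeff_hbMatrix_eq_zero hE hfin p (fun h' => hc (h'.symm.trans r.2)),
        zero_mul]
    refine Eq.trans ?_ h1.symm
    rw [mulVec, mulVec, dotProduct, dotProduct, map_sum, sum_eq_sum_subtype h2]
    exact Finset.sum_congr rfl fun c _ => (map_mul _ _ _).symm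
  · rintro ⟨w, rfl⟩
    let q : Fin (tOf E) → MvPolynomial (Fin 2) K :=
      fun c => if h : bOf E c = j then C (w ⟨c, h⟩) else 0
    refine ⟨extendRows j (degreeMatrix E p j *ᵥ w) - hbMatrix E p *ᵥ q, fun r => ?_, ?_⟩
    · rw [mem_span_X_iff, Pi.sub_apply, map_sub, sub_eq_zero, extendRows, mulVec, dotProduct,
        map_sum]
      by_cases hr : aOf E r = j
      · rw [dif_pos hr, constantCoeff_C, sum_eq_sum_subtype (P := fun c => bOf E c = j)
          fun c hc => by
            rw [map_mul, constantCoeff_hbMatrix_eq_zero hE hfin p (fun h' => hc (h' ▸ hr)),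
              zero_mul]]
        change ∑ c : Cols E j, degreeMatrix E p j ⟨r, hr⟩ c * w c = _
        refine Finset.sum_congr rfl fun c _ => ?_
        simp only [q]
        rw [map_mul, dif_pos c.2, constantCoeff_C]
        rfl
      · rw [dif_neg hr, map_zero, Finset.sum_eq_zero]
        intro c _
        simp only [q]
        split_ifs with hc
        · rw [map_mul, constantCoeff_hbMatrix_eq_zero hE hfin p (fun h' => hr (h'.trans hc)),
            zero_mul]
        · simp
    · simp only [Pi.sub_apply, sub_mul, Finset.sum_sub_distrib,
        IsHilbertBurchShape.sum_mulVec_mul_signedMinor, sub_zero]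

/-- The minors of degree `j` span the degree `j` part of `I / (x, y) I`, and the linear relations
between their classes form the image of `M(p)_j`. -/
theorem betti_hbIdeal (hE : IsMonomialIdeal E)
    (hfin : Module.Finite k (MvPolynomial (Fin 2) k ⧸ E)) (p : Param E → K) (j : ℕ) :
    betti (hbIdeal E p) j + (degreeMatrix E p j).rank = Fintype.card (Rows E j) := by
  classical
  set I := hbIdeal E p with hI
  set F := signedMinor (hbMatrix E p) with hF
  have hFI : ∀ r, F r ∈ I := fun r => by
    rw [hI, hbIdeal_eq_span_signedMinor]
    exact Ideal.subset_span ⟨r, rfl⟩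
  have hFh := isHomogeneous_signedMinor hE hfin p
  have hmem : ∀ v : Rows E j → K, ∑ r : Rows E j, v r • F r ∈ component I j := fun v => by
    refine Submodule.sum_mem _ fun r _ => Submodule.smul_mem _ _ ⟨hFI r, ?_⟩
    have := hFh r
    rwa [r.2] at this
  let ψ : (Rows E j → K) →ₗ[K] component I j :=
    LinearMap.codRestrict _ (Fintype.linearCombination K fun r : Rows E j => F r) fun v => by
      rw [Fintype.linearCombination_apply]
      exact hmem v
  let N := (component (Ideal.span {X 0, X 1} * I) j).submoduleOf (component I j)
  let φ := N.mkQ.comp ψ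
  have hker : LinearMap.ker φ = LinearMap.range (degreeMatrix E p j).mulVecLin := by
    ext v
    rw [LinearMap.mem_ker, LinearMap.comp_apply, Submodule.mkQ_apply,
      Submodule.Quotient.mk_eq_zero, LinearMap.mem_range]
    have h1 : ψ v ∈ N ↔ ∑ r : Rows E j, v r • F r ∈ component (Ideal.span {X 0, X 1} * I) j :=
      Iff.rfl
    rw [h1]
    have h2 : ∑ r : Rows E j, v r • F r ∈ component (Ideal.span {X 0, X 1} * I) j ↔
        ∑ r : Rows E j, v r • F r ∈ Ideal.span {X 0, X 1} * I :=
      ⟨fun h => h.1, fun h => ⟨h, (hmem v).2⟩⟩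
    rw [h2]
    exact sum_smul_signedMinor_mem_iff hE hfin p j v
  have hsurj : Function.Surjective φ := by
    intro y
    obtain ⟨⟨x, hx⟩, rfl⟩ := N.mkQ_surjective y
    have hxI : x ∈ Ideal.span (Set.range F) := by
      rw [hF, ← hbIdeal_eq_span_signedMinor]
      exact hx.1
    obtain ⟨h, rfl⟩ := Ideal.mem_span_range_iff_exists_fun.mp hxI
    refine ⟨fun r => constantCoeff (h r), ?_⟩
    refine (Submodule.Quotient.eq N).mpr ?_
    change ∑ r : Rows E j, constantCoeff (h r) • F r - ∑ r, h r * F r ∈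
      component (Ideal.span {X 0, X 1} * I) j
    refine ⟨?_, Submodule.sub_mem _ (hmem _).2 hx.2⟩
    -- Replacing coefficients by their constant terms changes the combination by an element of `(x,
    -- y) I`. Its component of degree `j` stays in this homogeneous ideal, and keeps only the minors
    -- of degree `j` in the constant combination.
    have hy : ∑ r, (C (constantCoeff (h r)) - h r) * F r ∈ Ideal.span {X 0, X 1} * I := by
      refine Ideal.sum_mem _ fun r _ => Ideal.mul_mem_mul ?_ (hFI r)
      rw [mem_span_X_iff, map_sub, constantCoeff_C, sub_self]
    have hy' := homogeneousComponent_mem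
      (Ideal.IsHomogeneous.mul isHomogeneous_span_X (isHomogeneous_hbIdeal hE hfin p)) hy j
    have heq : homogeneousComponent j (∑ r, (C (constantCoeff (h r)) - h r) * F r) =
        ∑ r : Rows E j, constantCoeff (h r) • F r - ∑ r, h r * F r := by
      simp only [sub_mul, Finset.sum_sub_distrib]
      rw [map_sub, homogeneousComponent_of_mem hx.2, if_pos rfl, map_sum]
      congr 1
      have hc : ∀ r, homogeneousComponent j (C (constantCoeff (h r)) * F r) =
          if j = aOf E r then constantCoeff (h r) • F r else 0 := fun r => by
        rw [homogeneousComponent_of_mem ((hFh r).C_mul _), smul_eq_C_mul]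
      simp only [hc]
      rw [sum_eq_sum_subtype (P := fun r => aOf E r = j) fun r hr => if_neg (Ne.symm hr)]
      exact Finset.sum_congr rfl fun r _ => if_pos r.2.symm
    rw [heq] at hy'
    exact hy'
  have h1 := φ.finrank_range_add_finrank_ker
  rw [hker, LinearMap.range_eq_top.mpr hsurj, finrank_top, Module.finrank_fintype_fun_eq_card] at h1
  exact h1

end Betti

end GroebnerCell

namespace GroebnerCell

open MvPolynomial Matrix

universe u

/-! ### Removing unit columns -/

section UnitColumns

/-- If some of the columns of a matrix are distinct unit vectors, then these columns and the rows
of their entries `1` can be removed: the rank drops by the number of these columns. -/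
theorem rank_eq_card_add_rank_submatrix {K m n : Type*} [Field K] [Fintype m] [Fintype n]
    (M : Matrix m n K) {P : n → Prop} [DecidablePred P] {f : {c // P c} → m}
    (hf : Function.Injective f) (h1 : ∀ c, M (f c) c = 1) (h0 : ∀ c r, r ≠ f c → M r c = 0) :
    M.rank = Fintype.card {c // P c} + (M.submatrix (Subtype.val : {r // r ∉ Set.range f} → m)
      (Subtype.val : {c // ¬ P c} → n)).rank := by
  classical
  set M' := M.submatrix (Subtype.val : {r // r ∉ Set.range f} → m)
    (Subtype.val : {c // ¬ P c} → n) with hM'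
  have hsum : ∀ (w : n → K) (r : m), (M *ᵥ w) r = ∑ c : {c // P c}, M r c * w c +
      ∑ c : {c // ¬ P c}, M r c * w c := fun w r =>
    (Fintype.sum_subtype_add_sum_subtype P fun c => M r c * w c).symm
  have hsum1 : ∀ (w : n → K) (c : {c // P c}), (M *ᵥ w) (f c) = w c +
      ∑ c' : {c // ¬ P c}, M (f c) c' * w c' := fun w c => by
    rw [hsum, Finset.sum_eq_single c, h1, one_mul]
    · intro c' _ hc'
      rw [h0 c' _ fun h => hc' (hf h.symm), zero_mul]
    · simp
  have hsum0 : ∀ (w : n → K) (r : {r // r ∉ Set.range f}), (M *ᵥ w) r =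
      (M' *ᵥ fun c => w c) r := fun w r => by
    rw [hsum, Finset.sum_eq_zero, zero_add]
    · rfl
    · intro c _
      rw [h0 c _ fun h => r.2 ⟨c, h.symm⟩, zero_mul]
  -- Forgetting the coordinates in `P` is bijective between the kernels: row `f c` expresses
  -- coordinate `c` through the remaining ones.
  let φ : LinearMap.ker M.mulVecLin →ₗ[K] LinearMap.ker M'.mulVecLin :=
    (LinearMap.funLeft K K Subtype.val).restrict fun w hw => by
      rw [LinearMap.mem_ker, mulVecLin_apply] at hw ⊢
      ext r
      exact (hsum0 w r).symm.trans (congrFun hw r)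
  have hφ : Function.Bijective φ := by
    constructor
    · rw [← LinearMap.ker_eq_bot, LinearMap.ker_eq_bot']
      rintro ⟨w, hw⟩ hφw
      have h2 : ∀ c : {c // ¬ P c}, w c = 0 := fun c => congrFun (congrArg Subtype.val hφw) c
      refine Subtype.ext (funext fun c => ?_)
      by_cases hc : P c
      · have h3 := hsum1 w ⟨c, hc⟩
        rw [Finset.sum_eq_zero fun c' _ => by rw [h2, mul_zero], add_zero] at h3
        exact h3.symm.trans (congrFun hw _)
      · exact h2 ⟨c, hc⟩
    · rintro ⟨v, hv⟩
      let w : n → K := fun c =>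
        if hc : P c then - ∑ c' : {c // ¬ P c}, M (f ⟨c, hc⟩) c' * v c' else v ⟨c, hc⟩
      have hw : (fun c : {c // ¬ P c} => w c) = v := funext fun c => dif_neg c.2
      refine ⟨⟨w, ?_⟩, Subtype.ext hw⟩
      rw [LinearMap.mem_ker, mulVecLin_apply]
      ext r
      by_cases hr : r ∈ Set.range f
      · obtain ⟨c, rfl⟩ := hr
        have h2 : w c = - ∑ c' : {c // ¬ P c}, M (f c) c' * v c' := dif_pos c.2
        rw [hsum1, h2, ← hw, neg_add_cancel, Pi.zero_apply]
      · rw [hsum0 w ⟨r, hr⟩, hw]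
        exact congrFun hv _
  have h2 := (LinearEquiv.ofBijective φ hφ).finrank_eq
  have h3 := M.mulVecLin.finrank_range_add_finrank_ker
  have h4 := M'.mulVecLin.finrank_range_add_finrank_ker
  have h5 := Fintype.card_subtype_compl P
  have h6 := Fintype.card_subtype_le P
  rw [Module.finrank_fintype_fun_eq_card] at h3 h4
  rw [Matrix.rank, Matrix.rank]
  omega

end UnitColumns

/-! ### The blocks `M(p)_j` and the strata -/

section DegreeMatrix

variable {k : Type u} [Field k] {E : Ideal (MvPolynomial (Fin 2) k)}

theorem uOf_eq_zero {j : ℕ} (r : Rows E j) (c : Cols E j) : uOf E r c = 0 := by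
  rw [uOf_eq, c.2, r.2, sub_self]

/-- Inside a block `u = 0`, so a parameter entry is the parameter itself. The entry `-x` has no
constant term, and `y^d` has one only for `d = 0`. -/
theorem degreeMatrix_apply {A : Type u} [CommRing A] (p : Param E → A) {j : ℕ} (r : Rows E j)
    (c : Cols E j) : degreeMatrix E p j r c =
      if h : ((c : Fin (tOf E)) : ℕ) < (r : Fin (tOf E + 1)) ∧ 0 ≤ uOf E r c ∧
        uOf E r c < dOf E c then p ⟨(r, c), h⟩
      else if ((r : Fin (tOf E + 1)) : ℕ) = (c : Fin (tOf E)) ∧ dOf E c = 0 then 1 else 0 := by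
  have h0 := uOf_eq_zero r c
  rw [degreeMatrix, hbMatrix, Matrix.add_apply, map_add, baseMatrix, paramMatrix]
  split_ifs with h1 h2 h3 h3 h4 h5 h6 <;> first | (exfalso; omega) | simp_all

/-- The row `i` of `M(p)_j`, for a column `i` with `d_i = 0`. -/
noncomputable def unitRow (hE : IsMonomialIdeal E)
    (hfin : Module.Finite k (MvPolynomial (Fin 2) k ⧸ E)) (j : ℕ)
    (c : {c : Cols E j // dOf E c = 0}) : Rows E j :=
  ⟨(c : Fin (tOf E)).castSucc, by
    -- For `d_i = 0` the equality `m_i = m_{i-1}` gives `a_i = b_i`, so the diagonal entry lies in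
    -- the block.
    have h1 := c.2
    have h2 := c.1.2
    rw [bOf_eq] at h2
    have h3 := mOf_monotone hE hfin (show ((c : Fin (tOf E)) : ℕ) ≤ (c : Fin (tOf E)) + 1 by omega)
    rw [dOf] at h1
    rw [aOf, Fin.val_castSucc]
    omega⟩

theorem unitRow_injective (hE : IsMonomialIdeal E)
    (hfin : Module.Finite k (MvPolynomial (Fin 2) k ⧸ E)) (j : ℕ) :
    Function.Injective (unitRow hE hfin j) := fun c c' h => by
  have h1 : (c : Fin (tOf E)).castSucc = (c' : Fin (tOf E)).castSucc := congrArg Subtype.val h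
  exact Subtype.ext (Subtype.ext (Fin.castSucc_injective _ h1))

/-- The pairs `(i, i')` such that the entry `(i, i')` of `M(p)_j` is a variable which is not in the
row of an entry `1`. They form a staircase. -/
abbrev StairVar (hE : IsMonomialIdeal E) (hfin : Module.Finite k (MvPolynomial (Fin 2) k ⧸ E))
    (j : ℕ) : Type :=
  Stair (fun r : {r : Rows E j // r ∉ Set.range (unitRow hE hfin j)} => ((r : Fin (tOf E + 1)) : ℕ))
    (fun c : {c : Cols E j // ¬ dOf E c = 0} => ((c : Fin (tOf E)) : ℕ))

/-- The inclusion of the variables of the staircase in all the variables. -/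
noncomputable def StairVar.toParam (hE : IsMonomialIdeal E)
    (hfin : Module.Finite k (MvPolynomial (Fin 2) k ⧸ E)) (j : ℕ) (q : StairVar hE hfin j) :
    Param E :=
  ⟨(q.1.1, q.1.2), q.2, (uOf_eq_zero q.1.1.1 q.1.2.1).ge, by
    rw [uOf_eq_zero q.1.1.1 q.1.2.1]
    exact Int.natCast_pos.mpr (Nat.pos_of_ne_zero q.1.2.2)⟩

variable (hE : IsMonomialIdeal E) (hfin : Module.Finite k (MvPolynomial (Fin 2) k ⧸ E))

theorem StairVar.toParam_injective (j : ℕ) : Function.Injective (toParam hE hfin j) :=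
  fun q q' h => by
    have h1 := congrArg Subtype.val h
    have h2 : (q.1.1 : Fin (tOf E + 1)) = q'.1.1 := congrArg Prod.fst h1
    have h3 : (q.1.2 : Fin (tOf E)) = q'.1.2 := congrArg Prod.snd h1
    exact Subtype.ext (Prod.ext (Subtype.ext (Subtype.ext h2)) (Subtype.ext (Subtype.ext h3)))

theorem StairVar.disjoint_range_toParam {i j : ℕ} (hij : i ≠ j) :
    Disjoint (Set.range (toParam hE hfin i)) (Set.range (toParam hE hfin j)) := by
  rw [Set.disjoint_left]
  rintro _ ⟨q, rfl⟩ ⟨q', h⟩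
  have h2 : (q'.1.1 : Fin (tOf E + 1)) = q.1.1 := congrArg Prod.fst (congrArg Subtype.val h)
  exact hij (q.1.1.1.2.symm.trans ((congrArg (aOf E) h2).symm.trans q'.1.1.1.2))

/-- A column with `d = 0` carries no parameter, because these require `0 ≤ u < d`; it is the unit
vector at its diagonal position. In the other columns every position below the diagonal carries its
own variable. -/
theorem rank_degreeMatrix {K : Type u} [Field K] (p : Param E → K) (j : ℕ) :
    (degreeMatrix E p j).rank = Fintype.card {c : Cols E j // dOf E c = 0} +
      (stairMatrix _ _ fun q : StairVar hE hfin j => p (q.toParam hE hfin j)).rank := by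
  rw [rank_eq_card_add_rank_submatrix _ (unitRow_injective hE hfin j)]
  · congr 2
    ext r c
    rw [submatrix_apply, degreeMatrix_apply, stairMatrix]
    have h0 := uOf_eq_zero r.1 c.1
    have hc := c.2
    by_cases h : ((c : Fin (tOf E)) : ℕ) < (r : Fin (tOf E + 1))
    · rw [dif_pos h, dif_pos ⟨h, by omega, by omega⟩]
      rfl
    · rw [dif_neg h, dif_neg fun h' => h h'.1, if_neg fun h' => hc h'.2]
  · intro c
    rw [degreeMatrix_apply, dif_neg, if_pos ⟨rfl, c.2⟩]
    exact fun h => (lt_irrefl _ h.1)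
  · intro c r hr
    have h0 := uOf_eq_zero r c.1
    have hc := c.2
    rw [degreeMatrix_apply, dif_neg fun h => by omega, if_neg]
    exact fun h => hr (Subtype.ext (Fin.ext h.1))

/-- The ideal of the determinantal variety `rank M(p)_j ≤ #w_j - u`, in the polynomial ring in the
variables of the staircase. -/
noncomputable def stairIdeal (j : ℕ) (u : ℤ) : Ideal (MvPolynomial (StairVar hE hfin j) k) :=
  if Fintype.card {c : Cols E j // dOf E c = 0} + u ≤ Fintype.card (Rows E j) then
    minorIdeal (genericStair _ _ k)
      (Fintype.card (Rows E j) - (Fintype.card {c : Cols E j // dOf E c = 0} + u)).toNat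
  -- A negative bound for the rank of the staircase matrix defines the empty set.
  else ⊤

theorem isPolynomialKernel_radical_stairIdeal {j : ℕ} {u : ℤ}
    (h : (stairIdeal hE hfin j u).radical.IsPrime) :
    IsPolynomialKernel k (stairIdeal hE hfin j u).radical := by
  classical
  rw [stairIdeal] at h ⊢
  split_ifs at h ⊢
  · exact isPolynomialKernel_radical_minorIdeal _ _ _
      ((PrimeSpectrum.isIrreducible_zeroLocus_iff _).mpr h)
  · exact absurd (Ideal.radical_top _) h.ne_top

theorem stairIdeal_eq_bot_or_eq_top {j : ℕ} (hj : j ∉ Finset.univ.image (aOf E)) (u : ℤ) :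
    stairIdeal hE hfin j u = ⊥ ∨ stairIdeal hE hfin j u = ⊤ := by
  have : IsEmpty (Rows E j) :=
    ⟨fun r => hj (Finset.mem_image.mpr ⟨r, Finset.mem_univ _, r.2⟩)⟩
  rw [stairIdeal]
  split_ifs
  · exact Or.inl (minorIdeal_of_isEmpty _ _)
  · exact Or.inr rfl

/-- A point lies in the zero locus exactly when the ideal dies in its residue field, where vanishing
of minors bounds the rank of the specialized staircase matrix. -/
theorem determinantalLocus_eq_zeroLocus (j : ℕ) (u : ℤ) :
    determinantalLocus E j u = PrimeSpectrum.zeroLocus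
      (extendVars (StairVar.toParam hE hfin j) (stairIdeal hE hfin j u) : Set (CoordRing E)) := by
  classical
  ext P
  have h1 := rank_degreeMatrix hE hfin (coords P) j
  rw [PrimeSpectrum.mem_zeroLocus, SetLike.coe_subset_coe,
    ← Ideal.ker_algebraMap_residueField P.asIdeal, ← Ideal.map_eq_bot_iff_le_ker, extendVars,
    Ideal.map_map, determinantalLocus, Set.mem_ofPred_eq, h1, stairIdeal]
  split_ifs with h
  · rw [← minorIdeal_map, genericStair, stairMatrix_map _ _ _ (map_zero _), minorIdeal_eq_bot_iff]
    have h2 : (fun q : StairVar hE hfin j =>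
        ((algebraMap (CoordRing E) P.asIdeal.ResidueField).comp
          (rename (R := k) (StairVar.toParam hE hfin j)).toRingHom) (X q)) =
        fun q => coords P (q.toParam hE hfin j) := by
      ext q
      simp [coords]
    rw [h2]
    omega
  · rw [Ideal.map_top]
    simp only [top_ne_bot, iff_false]
    omega

theorem stratumLocus_eq_determinantalLocus (hE : IsMonomialIdeal E)
    (hfin : Module.Finite k (MvPolynomial (Fin 2) k ⧸ E)) (j : ℕ) (u : ℤ) :
    stratumLocus E j u = determinantalLocus E j u := by
  ext P
  have h1 := hbIdeal_mem_cell hE hfin (coords P)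
  have h2 := betti_hbIdeal hE hfin (coords P) j
  rw [stratumLocus, determinantalLocus, Set.mem_ofPred_eq, Set.mem_ofPred_eq, stratumGE,
    Set.mem_ofPred_eq, and_iff_right h1]
  omega

theorem multiStratumLocus_eq_iInter (β : ℕ → ℤ) :
    multiStratumLocus E β = ⋂ j, stratumLocus E j (β j) := by
  ext P
  simp only [multiStratumLocus, multiStratumGE, stratumLocus, Set.mem_iInter, Set.mem_ofPred_eq]

theorem genericDegreeMatrix_apply_eq (j : ℕ) (r : Rows E j) (c : Cols E j) :
    genericDegreeMatrix E j r c = 0 ∨ genericDegreeMatrix E j r c = 1 ∨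
      ∃ s : Param E, s.1.1 = r ∧ genericDegreeMatrix E j r c = X s := by
  rw [genericDegreeMatrix, degreeMatrix_apply]
  split_ifs with h
  · exact Or.inr (Or.inr ⟨_, rfl, rfl⟩)
  · exact Or.inr (Or.inl rfl)
  · exact Or.inl rfl

theorem aOf_eq_of_mem_occurringVars {j : ℕ} {s : Param E} (hs : s ∈ occurringVars E j) :
    aOf E s.1.1 = j := by
  obtain ⟨r, c, hs⟩ := hs
  rcases genericDegreeMatrix_apply_eq j r c with h | h | ⟨s', h', h⟩ <;> rw [h] at hs
  · simp at hs
  · simp at hs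
  · rw [vars_X, Finset.mem_singleton] at hs
    rw [hs, h', r.2]

end DegreeMatrix

end GroebnerCell

open GroebnerCell in
theorem mainTheorem3 {k : Type*} [Field k] (E : Ideal (MvPolynomial (Fin 2) k))
    (hE : IsMonomialIdeal E) (hfin : Module.Finite k (MvPolynomial (Fin 2) k ⧸ E))
    (β : ℕ → ℤ) :
    -- the strata `V(E, j, ≥ β j)` are closed, and are the determinantal varieties of the `M(p)_j`
    (∀ j, IsClosed (stratumLocus E j (β j)) ∧
      stratumLocus E j (β j) = determinantalLocus E j (β j)) ∧
    -- the entries of the `M(p)_j` are `0`, `1` or variables, and these matrices involve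
    -- pairwise disjoint sets of variables
    (∀ j r c, genericDegreeMatrix E j r c = 0 ∨ genericDegreeMatrix E j r c = 1 ∨
      ∃ s, genericDegreeMatrix E j r c = MvPolynomial.X s) ∧
    (∀ i j, i ≠ j → Disjoint (occurringVars E i) (occurringVars E j)) ∧
    -- `V(E, ≥ β)` is the transversal intersection of the `V(E, j, ≥ β j)`
    multiStratumLocus E β = ⋂ j, stratumLocus E j (β j) ∧
    IntersectTransversally (fun j => stratumLocus E j (β j)) ∧
    -- its codimension is the sum of their codimensions
    codim (multiStratumLocus E β) = ∑' j, codim (stratumLocus E j (β j)) ∧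
    -- it is irreducible if and only if all of them are
    (IsIrreducible (multiStratumLocus E β) ↔
      ∀ j, IsIrreducible (stratumLocus E j (β j))) := by
  have hd := fun i j (h : i ≠ j) => StairVar.disjoint_range_toParam hE hfin h
  have hι := StairVar.toParam_injective hE hfin
  have hZ : ∀ j, stratumLocus E j (β j) = PrimeSpectrum.zeroLocus
      (extendVars (StairVar.toParam hE hfin j) (stairIdeal hE hfin j (β j)) :
        Set (CoordRing E)) := fun j =>
    (stratumLocus_eq_determinantalLocus hE hfin j _).trans
      (determinantalLocus_eq_zeroLocus hE hfin j _)
  -- Only the finitely many degrees `a_i` have rows; in every other degree the stratum is the whole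
  -- space or empty. This makes the intersection and the sum over all `j` finite in effect.
  have hF := fun j hj => stairIdeal_eq_bot_or_eq_top (j := j) hE hfin hj (β j)
  refine ⟨fun j => ⟨?_, stratumLocus_eq_determinantalLocus hE hfin j _⟩, fun j r c => ?_,
    fun i j hij => ?_, multiStratumLocus_eq_iInter β, ?_, ?_, ?_⟩
  · rw [hZ]
    exact PrimeSpectrum.isClosed_zeroLocus _
  · exact (genericDegreeMatrix_apply_eq j r c).imp_right (Or.imp_right fun ⟨s, _, h⟩ => ⟨s, h⟩)
  · rw [Set.disjoint_left]
    exact fun s hi hj =>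
      hij ((aOf_eq_of_mem_occurringVars hi).symm.trans (aOf_eq_of_mem_occurringVars hj))
  · exact intersectTransversally_of_disjoint hd _ hZ
  · rw [multiStratumLocus_eq_iInter]
    exact codim_iInter_eq_tsum hι hd _ hZ _ hF
  · rw [multiStratumLocus_eq_iInter]
    exact isIrreducible_iInter_iff hι hd _
      (fun j => isPolynomialKernel_radical_stairIdeal hE hfin) hZ _ hF
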